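/- An (a,b)-module is a free $\mathbb{C}[[b]]$-module $E$ of finite rank with a $\mathbb{C}$-linear endomorphism $a$ such that $a\,S = S\,a + b^2 S'$ for all $S\in\mathbb{C}[[b]]$; submodules are those stable by $\mathbb{C}[[b]]$ and $a$, and isomorphisms are $\mathbb{C}[[b]]$-linear and commute with $a$. $E$ has a simple pole if $aE\subset bE$; it is regular if it embeds in a simple pole (a,b)-module. The Bernstein polynomial $B_E$ of a regular $E$ is the minimal polynomial of $-b^{-1}a$ acting on $E^\sharp/bE^\sharp$, where $E^\sharp\subset E[b^{-1}]$ is the saturation of $E$ by $b^{-1}a$. A regular $E$ is geometric if all roots of $B_E$ are rational and strictly negative. A fresco is a geometric (a,b)-module generated by one element (no proper submodule contains the generator). A submodule $F\subset E$ is normal if $F\cap bE=bF$. For $\lambda\in\mathbb{C}$ let $E_\lambda=\mathbb{C}[[b]]\,e$ with $a e=\lambda b e$. A Jordan–Hölder sequence of $E$ of rank $k$ is a sequence $0=F_0\subset F_1\subset\dots\subset F_k=E$ of normal submodules with all $F_j/F_{j-1}$ of rank $1$. Fix any total order on $\mathbb{Q}/\mathbb{Z}$, and order $\mathbb{Q}$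 by first comparing classes modulo $\mathbb{Z}$ and then, within a class, using the usual order. A Jordan–Hölder sequence with $F_j/F_{j-1}\simeq E_{\lambda_j}$, $\lambda_j\in\mathbb{Q}$, is called principal if $j\mapsto\lambda_j+j$ is (weakly) increasing for this order on $\mathbb{Q}$. **Theorem.** Let $E$ be a fresco of rank $k$. Then $E$ has exactly one principal Jordan–Hölder sequence $(F_j)_{0\le j\le k}$. Its numbers $\lambda_1,\dots,\lambda_k$ (the fundamental invariants of $E$) are strictly positive, and $$B_E(x)=\prod_{j=1}^k\bigl(x+\lambda_j+j-k\bigr),$$ so that the opposites $\lambda_j+j-k$ of the roots of $B_E$, counted with multiplicity, appear in increasing order along the sequence. Moreover, if $E'$ is isomorphic to $E$ and $(F'_j)$ is the principal Jordan–Hölder sequence of $E'$, with numbers $\lambda'_j$, then $\lambda'_j=\lambda_j$ for all $j$, and $F'_j/F'_i\simeq F_j/F_i$ for all $0\le i\le j\le k$. -/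

import Mathlib

open scoped PowerSeries

universe u v

/-- A left module over the algebra generated by `a` and the power series in `b`: a module over
`ℂ⟦b⟧` (the variable `X` of the power series ring is `b`) with an additive endomorphism `a`
such that `a S = S a + b² S'` for every `S ∈ ℂ⟦b⟧`.  Taking `S` constant, `a` is `ℂ`-linear. -/
class ABStructure (E : Type u) [AddCommGroup E] [Module ℂ⟦X⟧ E] where
  a : E →+ E
  a_smul : ∀ (S : ℂ⟦X⟧) (x : E),
    a (S • x) = S • a x + (PowerSeries.X ^ 2 * PowerSeries.derivative ℂ S) • x

/-- The operator `a`. -/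
def aOp (E : Type u) [AddCommGroup E] [Module ℂ⟦X⟧ E] [ABStructure E] : E →+ E :=
  ABStructure.a

theorem aOp_smul {E : Type u} [AddCommGroup E] [Module ℂ⟦X⟧ E] [ABStructure E]
    (S : ℂ⟦X⟧) (x : E) :
    aOp E (S • x) = S • aOp E x + (PowerSeries.X ^ 2 * PowerSeries.derivative ℂ S) • x :=
  ABStructure.a_smul S x

/-- `b F` for a `ℂ⟦b⟧`-submodule `F` of `E`. -/
noncomputable def bTimes {E : Type u} [AddCommGroup E] [Module ℂ⟦X⟧ E] (F : Submodule ℂ⟦X⟧ E) :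
    Submodule ℂ⟦X⟧ E :=
  F.map (LinearMap.lsmul ℂ⟦X⟧ E (PowerSeries.X : ℂ⟦X⟧))

/-- `E` and `E'` are isomorphic: there is a `ℂ⟦b⟧`-linear bijection commuting with `a`. -/
def ABIso (E : Type u) [AddCommGroup E] [Module ℂ⟦X⟧ E] [ABStructure E]
    (E' : Type v) [AddCommGroup E'] [Module ℂ⟦X⟧ E'] [ABStructure E'] : Prop :=
  ∃ f : E ≃ₗ[ℂ⟦X⟧] E', ∀ x, f (aOp E x) = aOp E' (f x)

/-! ### Submodules, quotients, sub-quotients -/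

/-- A submodule stable by `a` and `ℂ⟦b⟧`. -/
@[ext]
structure ABSubmodule (E : Type u) [AddCommGroup E] [Module ℂ⟦X⟧ E] [ABStructure E]
    extends Submodule ℂ⟦X⟧ E where
  a_mem : ∀ x ∈ toSubmodule, aOp E x ∈ toSubmodule

section Sub

variable {E : Type u} [AddCommGroup E] [Module ℂ⟦X⟧ E] [ABStructure E]

noncomputable instance ABSubmodule.instABStructureCoe (F : ABSubmodule E) : ABStructure F.toSubmodule where
  a := ((aOp E).comp F.toSubmodule.subtype.toAddMonoidHom).codRestrict F.toSubmodule
    (fun x => F.a_mem x x.2)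
  a_smul S x := Subtype.ext (aOp_smul S (x : E))

noncomputable instance ABSubmodule.instABStructureQuot (F : ABSubmodule E) :
    ABStructure (E ⧸ F.toSubmodule) where
  a := QuotientAddGroup.map F.toSubmodule.toAddSubgroup F.toSubmodule.toAddSubgroup (aOp E)
    (fun x hx => F.a_mem x hx)
  a_smul S x := by
    obtain ⟨x, rfl⟩ := Submodule.Quotient.mk_surjective _ x
    exact congrArg (Submodule.Quotient.mk (p := F.toSubmodule)) (aOp_smul S x)

/-- `F ∩ G` as a submodule of `G`. -/
noncomputable def ABSubmodule.within (F G : ABSubmodule E) : ABSubmodule G.toSubmodule where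
  toSubmodule := F.toSubmodule.submoduleOf G.toSubmodule
  a_mem x hx := F.a_mem (x : E) hx

/-- The sub-quotient `G / F` (used for `F ⊆ G`). -/
abbrev ABSubmodule.SubQuot (F G : ABSubmodule E) : Type u :=
  G.toSubmodule ⧸ (F.within G).toSubmodule

/-- `F` is normal in `E` when `F ∩ b E = b F`. -/
def ABSubmodule.IsNormal (F : ABSubmodule E) : Prop :=
  F.toSubmodule ⊓ bTimes ⊤ = bTimes F.toSubmodule

end Sub

/-! ### The rank one modules `E_λ` -/

/-- `E_λ`, the free `ℂ⟦b⟧`-module with one generator `e` such that `a e = λ b e`;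
the power series `S` stands for `S e`, so that `a (S e) = b² S' e + λ b S e`. -/
def RankOne (_lam : ℂ) : Type := ℂ⟦X⟧

noncomputable instance (lam : ℂ) : AddCommGroup (RankOne lam) :=
  inferInstanceAs (AddCommGroup ℂ⟦X⟧)

noncomputable instance (lam : ℂ) : Module ℂ⟦X⟧ (RankOne lam) :=
  inferInstanceAs (Module ℂ⟦X⟧ ℂ⟦X⟧)

/-- The operator `S ↦ b² S' + λ b S` on `ℂ⟦b⟧`. -/
noncomputable def rankOneA (lam : ℂ) : ℂ⟦X⟧ →+ ℂ⟦X⟧ where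
  toFun S := PowerSeries.X ^ 2 * PowerSeries.derivative ℂ S
    + PowerSeries.C lam * PowerSeries.X * S
  map_zero' := by rw [map_zero, mul_zero, mul_zero, add_zero]
  map_add' S T := by rw [map_add]; ring

theorem rankOneA_mul (lam : ℂ) (S T : ℂ⟦X⟧) :
    rankOneA lam (S * T) =
      S * rankOneA lam T + (PowerSeries.X ^ 2 * PowerSeries.derivative ℂ S) * T := by
  simp only [rankOneA, AddMonoidHom.coe_mk, ZeroHom.coe_mk, Derivation.leibniz, smul_eq_mul]
  ring

noncomputable instance (lam : ℂ) : ABStructure (RankOne lam) where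
  a := rankOneA lam
  a_smul := rankOneA_mul lam

/-! ### The localization `E[b⁻¹]`, the saturation and the Bernstein polynomial -/

section Aux

variable {R M : Type*} [CommRing R] [AddCommGroup M] [Module R M] (x y ax ay : M)
  (s t w q ds dt dw : R)

theorem aux_add :
    (s * t) • (t • ax + (q * dt) • x + (s • ay + (q * ds) • y))
        - (q * (s * dt + t * ds)) • (t • x + s • y) =
      (t * t) • (s • ax - (q * ds) • x) + (s * s) • (t • ay - (q * dt) • y) := by
  module

theorem aux_smul :
    (s * s * s) • (s • (t • ax + (q * dt) • x) - (q * ds) • t • x) =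
      (s * s) • (s • t • (s • ax - (q * ds) • x) + (s * s) • (q * dt) • x) := by
  module

theorem aux_wd (hw : (w * t) • x = (w * s) • y)
    (h : (w * t) • ax + (q * (w * dt + t * dw)) • x =
      (w * s) • ay + (q * (w * ds + s * dw)) • y) :
    (w * w) • (t * t) • (s • ax - (q * ds) • x) =
      (w * w) • (s * s) • (t • ay - (q * dt) • y) := by
  linear_combination (norm := module) (w * s * t) • h - (w * t * ds * q) • hw
    - (w * s * dt * q) • hw - (s * t * dw * q) • hw

end Aux

section Bernstein

variable (E : Type u) [AddCommGroup E] [Module ℂ⟦X⟧ E] [ABStructure E]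

/-- `E[b⁻¹]`. -/
abbrev BLoc : Type u := LocalizedModule (Submonoid.powers (PowerSeries.X : ℂ⟦X⟧)) E

variable {E} in
/-- The formula `a (s⁻¹ x) = s⁻² (s a x - b² s' x)`. -/
noncomputable def locANum (x : E) (s : ℂ⟦X⟧) : E :=
  s • aOp E x - (PowerSeries.X ^ 2 * PowerSeries.derivative ℂ s) • x

theorem locANum_wd (x y : E) (s t w : ℂ⟦X⟧) (hw : w • t • x = w • s • y) :
    (w * w) • (t * t) • locANum x s = (w * w) • (s * s) • locANum y t := by
  have h := congrArg (aOp E) hw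
  simp only [smul_smul] at h hw
  simp only [aOp_smul, Derivation.leibniz, smul_eq_mul] at h
  exact aux_wd _ _ _ _ _ _ _ _ _ _ _ hw h

theorem locANum_add (x y : E) (s t : ℂ⟦X⟧) :
    locANum (t • x + s • y) (s * t) =
      (t * t) • locANum x s + (s * s) • locANum y t := by
  simp only [locANum, map_add, aOp_smul, Derivation.leibniz, smul_eq_mul]
  exact aux_add _ _ _ _ _ _ _ _ _

theorem locANum_smul (S : ℂ⟦X⟧) (x : E) (s : ℂ⟦X⟧) :
    (s * s * s) • locANum (S • x) s =
      (s * s) • (s • S • locANum x s +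
        (s * s) • (PowerSeries.X ^ 2 * PowerSeries.derivative ℂ S) • x) := by
  simp only [locANum, aOp_smul]
  exact aux_smul _ _ _ _ _ _ _

/-- The extension of `a` to `E[b⁻¹]`. -/
noncomputable def locAFun (z : BLoc E) : BLoc E :=
  LocalizedModule.liftOn z
    (fun p : E × Submonoid.powers (PowerSeries.X : ℂ⟦X⟧) =>
      (LocalizedModule.mk (locANum p.1 (p.2 : ℂ⟦X⟧)) (p.2 * p.2) : BLoc E))
    (by
      rintro ⟨x, s⟩ ⟨y, t⟩ ⟨w, hw⟩
      refine LocalizedModule.mk_eq.2 ⟨w * w, ?_⟩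
      simp only [Submonoid.smul_def, Submonoid.coe_mul] at hw ⊢
      exact locANum_wd E x y s t w hw)

theorem locAFun_mk (x : E) (s : Submonoid.powers (PowerSeries.X : ℂ⟦X⟧)) :
    locAFun E (LocalizedModule.mk x s) =
      LocalizedModule.mk (locANum x (s : ℂ⟦X⟧)) (s * s) :=
  LocalizedModule.liftOn_mk _ _ _

/-- The extension of `a` to `E[b⁻¹]`, with the same commutation rule. -/
noncomputable instance BLoc.instABStructure : ABStructure (BLoc E) where
  a := AddMonoidHom.mk' (locAFun E) (by
    intro z z'
    induction z, z' using LocalizedModule.induction_on₂ with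
    | _ x y s t =>
    rw [LocalizedModule.mk_add_mk, locAFun_mk, locAFun_mk, locAFun_mk, LocalizedModule.mk_add_mk]
    congr 1
    · exact locANum_add E x y s t
    · exact mul_mul_mul_comm s t s t)
  a_smul S z := by
    induction z using LocalizedModule.induction_on with
    | _ x s =>
    simp only [AddMonoidHom.mk'_apply]
    rw [LocalizedModule.smul'_mk, locAFun_mk, locAFun_mk, LocalizedModule.smul'_mk,
      LocalizedModule.smul'_mk, LocalizedModule.mk_add_mk]
    refine LocalizedModule.mk_eq.2 ⟨1, ?_⟩
    simp only [Submonoid.smul_def, Submonoid.coe_mul, one_smul]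
    exact locANum_smul E S x s

/-- `b⁻¹ a` on `E[b⁻¹]`. -/
noncomputable def bInvA : BLoc E →+ BLoc E :=
  (LocalizedModule.divBy (⟨PowerSeries.X, Submonoid.mem_powers _⟩ :
    Submonoid.powers (PowerSeries.X : ℂ⟦X⟧)) : BLoc E →ₗ[ℂ⟦X⟧] BLoc E).toAddMonoidHom.comp
    (aOp (BLoc E))

theorem X_smul_bInvA (z : BLoc E) :
    (PowerSeries.X : ℂ⟦X⟧) • bInvA E z = aOp (BLoc E) z :=
  LocalizedModule.mul_by_divBy (⟨PowerSeries.X, Submonoid.mem_powers _⟩ :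
    Submonoid.powers (PowerSeries.X : ℂ⟦X⟧)) _

theorem bInvA_smul (S : ℂ⟦X⟧) (z : BLoc E) :
    bInvA E (S • z) = S • bInvA E z
      + (PowerSeries.X * PowerSeries.derivative ℂ S) • z := by
  have h : ∀ w : BLoc E, (LocalizedModule.divBy (⟨PowerSeries.X, Submonoid.mem_powers _⟩ :
      Submonoid.powers (PowerSeries.X : ℂ⟦X⟧)) : BLoc E →ₗ[ℂ⟦X⟧] BLoc E)
      ((PowerSeries.X : ℂ⟦X⟧) • w) = w := fun w => LocalizedModule.divBy_mul_by
        (⟨PowerSeries.X, Submonoid.mem_powers _⟩ : Submonoid.powers (PowerSeries.X : ℂ⟦X⟧)) w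
  simp only [bInvA, AddMonoidHom.coe_comp, Function.comp_apply, LinearMap.toAddMonoidHom_coe,
    aOp_smul, map_add, map_smul]
  rw [pow_two, mul_assoc, mul_smul, ← map_smul _ S, smul_comm PowerSeries.X,
    ← map_smul _ PowerSeries.X, h]

/-- The saturation of `E` by `b⁻¹ a`: the smallest `ℂ⟦b⟧`-submodule of `E[b⁻¹]` which contains
(the image of) `E` and is stable by `b⁻¹ a`. -/
noncomputable def saturation : Submodule ℂ⟦X⟧ (BLoc E) :=
  sInf {G | LinearMap.range (LocalizedModule.mkLinearMap
      (Submonoid.powers (PowerSeries.X : ℂ⟦X⟧)) E) ≤ G ∧ ∀ z ∈ G, bInvA E z ∈ G}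

theorem bInvA_mem_saturation (z : BLoc E) (hz : z ∈ saturation E) :
    bInvA E z ∈ saturation E := by
  simp only [saturation, Submodule.mem_sInf, Set.mem_ofPred_eq] at hz ⊢
  exact fun G hG => hG.2 _ (hz G hG)

/-- `b⁻¹ a` on the saturation. -/
noncomputable def satOp : saturation E →+ saturation E :=
  ((bInvA E).comp (saturation E).subtype.toAddMonoidHom).codRestrict (saturation E)
    (fun z => bInvA_mem_saturation E z z.2)

theorem satOp_smul (S : ℂ⟦X⟧) (z : saturation E) :
    satOp E (S • z) = S • satOp E z
      + (PowerSeries.X * PowerSeries.derivative ℂ S) • z :=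
  Subtype.ext (bInvA_smul E S (z : BLoc E))

/-- The quotient of the saturation by `b` times the saturation. -/
def SatFibre : Type u := saturation E ⧸ (bTimes ⊤ : Submodule ℂ⟦X⟧ (saturation E))

noncomputable instance : AddCommGroup (SatFibre E) :=
  inferInstanceAs (AddCommGroup (saturation E ⧸ (bTimes ⊤ : Submodule ℂ⟦X⟧ (saturation E))))

noncomputable instance : Module ℂ⟦X⟧ (SatFibre E) :=
  inferInstanceAs (Module ℂ⟦X⟧
    (saturation E ⧸ (bTimes ⊤ : Submodule ℂ⟦X⟧ (saturation E))))

/-- The structure of complex vector space, through the constant power series. -/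
noncomputable instance : Module ℂ (SatFibre E) :=
  Module.compHom (SatFibre E) (PowerSeries.C : ℂ →+* ℂ⟦X⟧)

/-- The endomorphism induced by `b⁻¹ a` on the quotient of the saturation by `b`. -/
noncomputable def satFibreOp : Module.End ℂ (SatFibre E) where
  toFun := QuotientAddGroup.map
    (bTimes ⊤ : Submodule ℂ⟦X⟧ (saturation E)).toAddSubgroup
    (bTimes ⊤ : Submodule ℂ⟦X⟧ (saturation E)).toAddSubgroup (satOp E) (by
      rintro _ ⟨z, -, rfl⟩
      refine ⟨satOp E z + z, trivial, ?_⟩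
      simp only [LinearMap.lsmul_apply, satOp_smul, PowerSeries.derivative_X, mul_one, smul_add])
  map_add' := map_add _
  map_smul' c x := by
    obtain ⟨z, rfl⟩ := Submodule.Quotient.mk_surjective _ x
    refine congrArg (Submodule.Quotient.mk
      (p := (bTimes ⊤ : Submodule ℂ⟦X⟧ (saturation E)))) (?_ :
        satOp E (PowerSeries.C c • z) = PowerSeries.C c • satOp E z)
    rw [satOp_smul, PowerSeries.derivative_C, mul_zero, zero_smul, add_zero]

/-- The Bernstein polynomial: the minimal polynomial of `-b⁻¹ a` acting on the quotient of the
saturation of `E` by `b` times the saturation. -/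
noncomputable def bernsteinPoly : Polynomial ℂ := minpoly ℂ (-satFibreOp E)

end Bernstein

/-! ### Frescos -/

/-- `E` is an (a,b)-module: `ℂ⟦b⟧`-free of finite rank. -/
structure IsABModule (E : Type u) [AddCommGroup E] [Module ℂ⟦X⟧ E] [ABStructure E] : Prop where
  free : Module.Free ℂ⟦X⟧ E
  finite : Module.Finite ℂ⟦X⟧ E

/-- `E` has a simple pole: `a E ⊆ b E`. -/
def HasSimplePole (E : Type u) [AddCommGroup E] [Module ℂ⟦X⟧ E] [ABStructure E] : Prop :=
  ∀ x : E, aOp E x ∈ (bTimes ⊤ : Submodule ℂ⟦X⟧ E)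

/-- `E` is regular: it embeds in a simple pole (a,b)-module. -/
def IsRegularAB (E : Type u) [AddCommGroup E] [Module ℂ⟦X⟧ E] [ABStructure E] : Prop :=
  ∃ (E' : Type u) (_ : AddCommGroup E') (_ : Module ℂ⟦X⟧ E') (_ : ABStructure E')
    (f : E →ₗ[ℂ⟦X⟧] E'), IsABModule E' ∧ HasSimplePole E' ∧
      Function.Injective f ∧ ∀ x, f (aOp E x) = aOp E' (f x)

/-- `E` is geometric: regular, and all roots of its Bernstein polynomial are rational and
strictly negative. -/
def IsGeometricAB (E : Type u) [AddCommGroup E] [Module ℂ⟦X⟧ E] [ABStructure E] : Prop :=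
  IsRegularAB E ∧ ∀ z : ℂ, (bernsteinPoly E).IsRoot z → ∃ q : ℚ, q < 0 ∧ z = (q : ℂ)

/-- A fresco: a geometric (a,b)-module generated by one element. -/
structure IsFresco (E : Type u) [AddCommGroup E] [Module ℂ⟦X⟧ E] [ABStructure E] : Prop where
  abModule : IsABModule E
  geometric : IsGeometricAB E
  monogenic : ∃ e : E, ∀ F : ABSubmodule E, e ∈ F.toSubmodule → F.toSubmodule = ⊤

/-! ### Jordan–Hölder sequences -/

/-- The order on `ℚ` attached to a total order on `ℚ / ℤ`: first compare the classes modulo `ℤ`,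
then, inside a class, use the usual order. -/
def ratLE (ord : LinearOrder (AddCircle (1 : ℚ))) (p q : ℚ) : Prop :=
  ord.lt (p : AddCircle (1 : ℚ)) (q : AddCircle (1 : ℚ)) ∨
    ((p : AddCircle (1 : ℚ)) = (q : AddCircle (1 : ℚ)) ∧ p ≤ q)

section JH

variable {E : Type u} [AddCommGroup E] [Module ℂ⟦X⟧ E] [ABStructure E] {k : ℕ}

/-- A Jordan–Hölder sequence `0 = F_0 ⊆ F_1 ⊆ ⋯ ⊆ F_k = E`: normal submodules with
sub-quotients `F_j / F_{j-1}` of rank one. -/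
structure IsJHSeq (F : Fin (k + 1) → ABSubmodule E) : Prop where
  zero : (F 0).toSubmodule = ⊥
  last : (F (Fin.last k)).toSubmodule = ⊤
  le : ∀ j : Fin k, (F j.castSucc).toSubmodule ≤ (F j.succ).toSubmodule
  normal : ∀ j, (F j).IsNormal
  rank_one : ∀ j : Fin k, Module.finrank ℂ⟦X⟧ ((F j.castSucc).SubQuot (F j.succ)) = 1

/-- `F` is a principal Jordan–Hölder sequence with `F_j / F_{j-1} ≃ E_{λ_j}`: the numbers
`λ_j` are rational and `λ_j + j` is (weakly) increasing for the order on `ℚ` attached to `ord`.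
The index `j ∈ [1, k]` is `i + 1` for `i : Fin k`. -/
structure IsPrincipalJH (ord : LinearOrder (AddCircle (1 : ℚ)))
    (F : Fin (k + 1) → ABSubmodule E) (lam : Fin k → ℚ) : Prop where
  jh : IsJHSeq F
  iso : ∀ j : Fin k, ABIso ((F j.castSucc).SubQuot (F j.succ)) (RankOne (lam j : ℂ))
  incr : ∀ i j : Fin k, i ≤ j →
    ratLE ord (lam i + ((i : ℕ) + 1 : ℚ)) (lam j + ((j : ℕ) + 1 : ℚ))

end JH

/-!
Call a basis `e_0, …, e_{k-1}` of `E` triangular when `(a - λ_j b) e_j` lies in the span `G_j` of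
the preceding vectors.  The flags `(G_j)` of triangular bases are exactly the Jordan–Hölder
sequences with quotients `E_{λ_j}` (`IsPrincipalJH.exists_triangular`,
`IsTriangular.isPrincipalJH`), so the theorem is proved for triangular bases.  Indices start at `0`
here, so that `λ_j + j` of the informal statement is `λ_j + j + 1`.

*Existence of a triangular basis.*  A regular module contains a lattice stable by `b⁻¹ a`.  On such
a lattice `b⁻¹ a` has an eigenvector, obtained by solving a differential system with a simple pole
coefficient by coefficient (`exists_eigenvector`).  Dividing it by a power of `b` makes it generate
a normal submodule, and one continues in the quotient (`exists_triangular`).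

*Normal form.*  If `E` is generated by one element, each `G_j` is too, and the vectors can be
changed without changing the flag so that `(a - λ_{j+1} b) e_{j+1} = U_j e_j` with `U_j` invertible and
`(a - λ_0 b) e_0 = 0` (`IsTriangular.exists_chain`).

*Bernstein polynomial.*  In a normal form the saturation has the basis `f_j = b^{-(k-1-j)} e_j`, and
`b⁻¹ a f_{j+1} = (λ_{j+1} + j + 2 - k) f_{j+1} + U_j f_j`.  On the fibre this is a bidiagonal
matrix with nonzero off-diagonal entries, so its minimal polynomial is the characteristic polynomial
(`IsABChain.bernsteinPoly_eq`).  As the roots are negative rational numbers, the `λ_j` are rational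
and positive.

*Sorting.*  If `λ_i + i` is larger than `λ_{i+1} + i + 1`, then `λ_i - λ_{i+1} - 1` is not an
integer `≤ 0`, an equation `b T' + (λ_i - λ_{i+1} - 1) T = -U_i` can be solved, and
`b e_{i+1} + T e_i` replaces `e_i` (`IsTriangular.exists_swap`).  This exchanges the two numbers
`λ_i + i` and `λ_{i+1} + i + 1`, and sorting by adjacent exchanges gives a principal sequence.

*Uniqueness.*  The Bernstein polynomial determines the sorted numbers.  If two principal flags agree
up to the step `j`, the next vector `x` of one of them satisfies `(a - λ_j b) x ∈ G_j`; in the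
coordinates of a normal form of the other, divisibility by powers of `b` and the order of the
`λ_i + i` force `x ∈ G_{j+1}` (`IsABChain.mem_flagSpan_of_eigenvector`).  Invariance under
isomorphisms follows by transporting one sequence to the other module.
-/

/-! ### The operators `a - λ b` and `S ↦ b² S' + λ b S` -/

section Operator

variable {E : Type u} [AddCommGroup E] [Module ℂ⟦X⟧ E] [ABStructure E]

theorem smul_shift_aux {R M : Type*} [CommRing R] [AddCommGroup M] [Module R M] (x ax : M)
    (S q dS l m : R) :
    S • ax + (q * dS) • x - m • S • x = S • (ax - l • x) + (q * dS + (l - m) * S) • x := by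
  module

/-- The operator `a - λ b`, bundled as an additive map because it is not `ℂ⟦b⟧`-linear: it commutes
with `S ∈ ℂ⟦b⟧` up to the term `b² S'`. -/
noncomputable def aSub (E : Type u) [AddCommGroup E] [Module ℂ⟦X⟧ E] [ABStructure E] (lam : ℂ) :
    E →+ E :=
  aOp E - DistribSMul.toAddMonoidHom E (PowerSeries.C lam * PowerSeries.X : ℂ⟦X⟧)

theorem aSub_apply (lam : ℂ) (x : E) :
    aSub E lam x = aOp E x - (PowerSeries.C lam * PowerSeries.X : ℂ⟦X⟧) • x := rfl

theorem aOp_eq (lam : ℂ) (x : E) :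
    aOp E x = (PowerSeries.C lam * PowerSeries.X : ℂ⟦X⟧) • x + aSub E lam x := by
  rw [aSub_apply]; abel

theorem rankOneA_apply (lam : ℂ) (S : ℂ⟦X⟧) :
    rankOneA lam S = PowerSeries.X ^ 2 * PowerSeries.derivative ℂ S
      + PowerSeries.C lam * PowerSeries.X * S := rfl

theorem aSub_smul (lam mu : ℂ) (S : ℂ⟦X⟧) (x : E) :
    aSub E mu (S • x) = S • aSub E lam x + rankOneA (lam - mu) S • x := by
  rw [aSub_apply, aSub_apply, aOp_smul, rankOneA_apply, map_sub, sub_mul]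
  exact smul_shift_aux _ _ _ _ _ _ _

theorem coeff_succ_rankOneA (lam : ℂ) (S : ℂ⟦X⟧) (n : ℕ) :
    PowerSeries.coeff (n + 1) (rankOneA lam S) = (n + lam) * PowerSeries.coeff n S := by
  have h : rankOneA lam S = PowerSeries.X * (PowerSeries.X * PowerSeries.derivative ℂ S
      + PowerSeries.C lam * S) := by
    rw [rankOneA_apply]; ring
  rw [h, PowerSeries.coeff_succ_X_mul, map_add, PowerSeries.coeff_C_mul]
  cases n with
  | zero => simp
  | succ n =>
    rw [PowerSeries.coeff_succ_X_mul, PowerSeries.coeff_derivative]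
    push_cast; ring

theorem coeff_zero_rankOneA (lam : ℂ) (S : ℂ⟦X⟧) :
    PowerSeries.coeff 0 (rankOneA lam S) = 0 := by
  simp [rankOneA_apply]

/-- A nonzero solution of `b² S' + λ b S = 0` is a monomial of degree `-λ`. -/
theorem exists_coeff_ne_zero_of_rankOneA_eq_zero {lam : ℂ} {S : ℂ⟦X⟧} (h : rankOneA lam S = 0)
    (hS : S ≠ 0) : ∃ n : ℕ, (n : ℂ) + lam = 0 ∧ PowerSeries.coeff n S ≠ 0 := by
  obtain ⟨n, hn⟩ : ∃ n, PowerSeries.coeff n S ≠ 0 := by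
    by_contra! hc
    exact hS (PowerSeries.ext fun n => by simpa using hc n)
  refine ⟨n, ?_, hn⟩
  have := coeff_succ_rankOneA lam S n
  rw [h, map_zero] at this
  exact (mul_eq_zero.1 this.symm).resolve_right hn

/-- The equation `b T' + λ T = U` has a power series solution when `-λ` is not a natural
number. -/
theorem exists_rankOneA_eq {lam : ℂ} (h : ∀ n : ℕ, (n : ℂ) + lam ≠ 0) (U : ℂ⟦X⟧) :
    ∃ T : ℂ⟦X⟧, rankOneA lam T = PowerSeries.X * U := by
  refine ⟨PowerSeries.mk fun n => PowerSeries.coeff n U / (n + lam), PowerSeries.ext fun n => ?_⟩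
  cases n with
  | zero => simp [coeff_zero_rankOneA]
  | succ n =>
    rw [coeff_succ_rankOneA, PowerSeries.coeff_succ_X_mul, PowerSeries.coeff_mk,
      mul_div_cancel₀ _ (h n)]

theorem X_pow_succ_dvd_rankOneA (lam : ℂ) {S : ℂ⟦X⟧} {d : ℕ} (h : PowerSeries.X ^ d ∣ S) :
    PowerSeries.X ^ (d + 1) ∣ rankOneA lam S := by
  rw [PowerSeries.X_pow_dvd_iff] at h ⊢
  intro m hm
  cases m with
  | zero => exact coeff_zero_rankOneA _ _
  | succ m => rw [coeff_succ_rankOneA, h m (by omega), mul_zero]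

end Operator

/-! ### Flags spanned by a sequence of vectors -/

section Flag

variable {E : Type u} [AddCommGroup E] [Module ℂ⟦X⟧ E]

/-- The span of the first `j` vectors of the sequence `e`. -/
noncomputable def flagSpan (e : ℕ → E) (j : ℕ) : Submodule ℂ⟦X⟧ E :=
  Submodule.span ℂ⟦X⟧ (e '' Set.Iio j)

theorem flagSpan_zero (e : ℕ → E) : flagSpan e 0 = ⊥ := by
  simp [flagSpan]

theorem flagSpan_succ (e : ℕ → E) (j : ℕ) :
    flagSpan e (j + 1) = Submodule.span ℂ⟦X⟧ {e j} ⊔ flagSpan e j := by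
  rw [flagSpan, flagSpan, ← Submodule.span_union, ← Set.image_singleton, ← Set.image_union]
  congr 2
  ext i
  simp only [Set.mem_Iio, Set.singleton_union, Set.mem_insert_iff]
  omega

theorem flagSpan_mono (e : ℕ → E) : Monotone (flagSpan e) := fun _ _ h =>
  Submodule.span_mono (Set.image_mono (Set.Iio_subset_Iio h))

theorem mem_flagSpan (e : ℕ → E) {i j : ℕ} (h : i < j) : e i ∈ flagSpan e j :=
  Submodule.subset_span ⟨i, h, rfl⟩

theorem mem_flagSpan_succ {e : ℕ → E} {j : ℕ} {x : E} :
    x ∈ flagSpan e (j + 1) ↔ ∃ S : ℂ⟦X⟧, ∃ h ∈ flagSpan e j, x = S • e j + h := by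
  rw [flagSpan_succ, Submodule.mem_sup]
  constructor
  · rintro ⟨y, hy, h, hh, rfl⟩
    obtain ⟨S, rfl⟩ := Submodule.mem_span_singleton.1 hy
    exact ⟨S, h, hh, rfl⟩
  · rintro ⟨S, h, hh, rfl⟩
    exact ⟨_, Submodule.smul_mem _ _ (Submodule.mem_span_singleton_self _), h, hh, rfl⟩

theorem flagSpan_congr {e e' : ℕ → E} {j : ℕ} (h : ∀ i < j, e' i - e i ∈ flagSpan e i) :
    flagSpan e' j = flagSpan e j := by
  induction j with
  | zero => rw [flagSpan_zero, flagSpan_zero]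
  | succ j ih =>
    have ih := ih fun i hi => h i (by omega)
    have hj := h j (by omega)
    refine le_antisymm ?_ ?_ <;> intro x hx <;> obtain ⟨S, y, hy, rfl⟩ := mem_flagSpan_succ.1 hx
    · refine mem_flagSpan_succ.2 ⟨S, S • (e' j - e j) + y,
        add_mem (Submodule.smul_mem _ _ hj) (ih ▸ hy), by rw [smul_sub]; abel⟩
    · refine mem_flagSpan_succ.2 ⟨S, y - S • (e' j - e j), ?_, by rw [smul_sub]; abel⟩
      rw [ih]
      exact sub_mem hy (Submodule.smul_mem _ _ hj)

theorem flagSpan_congr' {e e' : ℕ → E} {j : ℕ} (h : ∀ i < j, e' i = e i) :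
    flagSpan e' j = flagSpan e j :=
  flagSpan_congr fun i hi => by rw [h i hi, sub_self]; exact zero_mem _

/-- Linear independence is assumed step by step: no nonzero multiple of `e j` lies in the span of
the preceding vectors.  Then a combination which lies in a step of the flag only involves the
vectors of that step. -/
theorem sum_smul_mem_flagSpan {e : ℕ → E} {n : ℕ}
    (hind : ∀ j < n, ∀ S : ℂ⟦X⟧, S • e j ∈ flagSpan e j → S = 0) (T : ℕ → ℂ⟦X⟧) {j : ℕ}
    (h : ∑ i ∈ Finset.range n, T i • e i ∈ flagSpan e j) :
    ∀ i, j ≤ i → i < n → T i = 0 := by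
  induction n with
  | zero => intro i _ hi; omega
  | succ n ih =>
    rw [Finset.sum_range_succ] at h
    have hlow : ∑ i ∈ Finset.range n, T i • e i ∈ flagSpan e n :=
      sum_mem fun i hi => Submodule.smul_mem _ _ (mem_flagSpan e (Finset.mem_range.1 hi))
    intro i hji hi
    have hjn : j ≤ n := by omega
    have hT : T n = 0 := hind n (by omega) _ <| by
      have := sub_mem (flagSpan_mono e hjn h) hlow
      rwa [add_sub_cancel_left] at this
    rcases Nat.lt_succ_iff_lt_or_eq.1 hi with hi | rfl
    · rw [hT, zero_smul, add_zero] at h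
      exact ih (fun j hj => hind j (by omega)) h i hji hi
    · exact hT

theorem linearIndependent_of_flag {e : ℕ → E} {n : ℕ}
    (hind : ∀ j < n, ∀ S : ℂ⟦X⟧, S • e j ∈ flagSpan e j → S = 0) :
    LinearIndependent ℂ⟦X⟧ fun j : Fin n => e j := by
  rw [Fintype.linearIndependent_iff]
  intro g hg i
  have := sum_smul_mem_flagSpan hind (fun m => if h : m < n then g ⟨m, h⟩ else 0) (j := 0)
    (by
      rw [Finset.sum_range]
      simp only [Fin.is_lt, dite_true, Fin.eta]
      rw [hg]; exact zero_mem _) i (Nat.zero_le _) i.2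
  simpa using this

theorem exists_sum_of_mem_flagSpan {e : ℕ → E} {n : ℕ} {x : E} (hx : x ∈ flagSpan e n) :
    ∃ T : ℕ → ℂ⟦X⟧, x = ∑ i ∈ Finset.range n, T i • e i := by
  induction n generalizing x with
  | zero => exact ⟨0, by simpa [flagSpan_zero] using hx⟩
  | succ n ih =>
    obtain ⟨S, y, hy, rfl⟩ := mem_flagSpan_succ.1 hx
    obtain ⟨T, rfl⟩ := ih hy
    refine ⟨Function.update T n S, ?_⟩
    rw [Finset.sum_range_succ, Function.update_self, add_comm]
    congr 1
    refine Finset.sum_congr rfl fun i hi => ?_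
    rw [Function.update_of_ne (Finset.mem_range.1 hi).ne]

end Flag

/-! ### Eigenvectors of `b⁻¹ a` on a simple pole module -/

section Eigenvector

/-- A differential system `b x' + A(b) x = λ x` with power series coefficients has a nonzero
formal solution, for `λ` an eigenvalue of `A(0)` of minimal real part: then `λ - n` is not an
eigenvalue for `n ≥ 1`, so that the coefficients of `x` are determined one after the other. -/
theorem exists_formal_solution {ι : Type*} [Fintype ι] [Nonempty ι]
    (A : ℕ → Module.End ℂ (ι → ℂ)) :
    ∃ (lam : ℂ) (y : ℕ → ι → ℂ), y 0 ≠ 0 ∧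
      ∀ n, ∑ q ∈ Finset.range n, A (n - q) (y q) + A 0 (y n) + (n : ℂ) • y n = lam • y n := by
  classical
  have hfin : {z : ℂ | (A 0).HasEigenvalue z}.Finite := Module.End.finite_hasEigenvalue (A 0)
  obtain ⟨lam, hlam, hmin⟩ := Set.exists_min_image _ Complex.re hfin
    (Module.End.exists_eigenvalue (A 0))
  obtain ⟨v, hv⟩ := Module.End.HasEigenvalue.exists_hasEigenvector hlam
  have hsurj : ∀ n : ℕ, 0 < n → Function.Surjective
      (A 0 - algebraMap ℂ (Module.End ℂ (ι → ℂ)) (lam - n)) := by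
    intro n hn
    rw [← LinearMap.injective_iff_surjective, ← LinearMap.ker_eq_bot,
      Algebra.algebraMap_eq_smul_one, ← Module.End.eigenspace_def]
    by_contra hne
    have h := hmin (lam - n) (Module.End.hasEigenvalue_iff.2 hne)
    have : (0 : ℝ) < n := by exact_mod_cast hn
    simp only [Complex.sub_re, Complex.natCast_re] at h
    linarith
  choose! g hg using hsurj
  let step : (n : ℕ) → ((m : ℕ) → m < n → (ι → ℂ)) → (ι → ℂ) := fun n y =>
    if n = 0 then v else
      g n (-∑ q ∈ (Finset.range n).attach, A (n - q) (y q (Finset.mem_range.1 q.2)))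
  let y : ℕ → ι → ℂ := Nat.lt_wfRel.wf.fix step
  have hy : ∀ n, y n = step n fun m _ => y m := fun n => WellFounded.fix_eq _ _ _
  have hy0 : y 0 = v := by rw [hy]; simp [step]
  refine ⟨lam, y, hy0 ▸ hv.2, fun n => ?_⟩
  rcases Nat.eq_zero_or_pos n with rfl | hn
  · simp [hy0, hv.apply_eq_smul]
  · have h1 : y n = g n (-∑ q ∈ Finset.range n, A (n - q) (y q)) := by
      rw [hy]
      simp only [step, hn.ne', if_false]
      rw [Finset.sum_attach (Finset.range n) fun q => A (n - q) (y q)]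
    have h2 := hg n hn (-∑ q ∈ Finset.range n, A (n - q) (y q))
    rw [← h1, LinearMap.sub_apply, Module.algebraMap_end_apply] at h2
    have h3 : ∑ q ∈ Finset.range n, A (n - q) (y q) = -(A 0 (y n) - (lam - n) • y n) := by
      rw [h2, neg_neg]
    rw [h3]
    module

/-- A nonzero free module of finite rank with a simple pole has an eigenvector of `b⁻¹ a`. -/
theorem exists_eigenvector {M : Type u} [AddCommGroup M] [Module ℂ⟦X⟧ M] [Module.Free ℂ⟦X⟧ M]
    [Module.Finite ℂ⟦X⟧ M] [Nontrivial M] (θ : M →+ M)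
    (hθ : ∀ (S : ℂ⟦X⟧) (x : M),
      θ (S • x) = S • θ x + (PowerSeries.X * PowerSeries.derivative ℂ S) • x) :
    ∃ (lam : ℂ) (x : M), x ≠ 0 ∧ θ x = (PowerSeries.C lam : ℂ⟦X⟧) • x := by
  classical
  let ι := Module.Free.ChooseBasisIndex ℂ⟦X⟧ M
  let B : Module.Basis ι ℂ⟦X⟧ M := Module.Free.chooseBasis ℂ⟦X⟧ M
  have : Nonempty ι := B.index_nonempty
  let A : ℕ → Matrix ι ι ℂ := fun n => Matrix.of fun i j =>
    PowerSeries.coeff n (B.repr (θ (B j)) i)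
  obtain ⟨lam, y, hy0, hy⟩ := exists_formal_solution fun n => Matrix.toLin' (A n)
  let T : ι → ℂ⟦X⟧ := fun i => PowerSeries.mk fun n => y n i
  refine ⟨lam, ∑ j, T j • B j, fun h0 => hy0 ?_, B.repr.injective (Finsupp.ext fun i => ?_)⟩
  · have h := fun i => congrArg (fun z => B.repr z i) h0
    simp only [B.repr_sum_self, map_zero, Finsupp.zero_apply] at h
    funext i
    have := congrArg (PowerSeries.coeff 0) (h i)
    rwa [PowerSeries.coeff_mk, map_zero] at this
  · have h1 : θ (∑ j, T j • B j) = ∑ j, T j • θ (B j)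
        + ∑ j, (PowerSeries.X * PowerSeries.derivative ℂ (T j)) • B j := by
      rw [map_sum, ← Finset.sum_add_distrib]
      exact Finset.sum_congr rfl fun j _ => hθ _ _
    rw [h1, map_add, map_smul, Finsupp.add_apply, Finsupp.smul_apply, B.repr_sum_self,
      B.repr_sum_self, map_sum, Finsupp.finsetSum_apply]
    ext n
    have h2 := congrFun (hy n) i
    simp only [Pi.add_apply, Pi.smul_apply, Finset.sum_apply, Matrix.toLin'_apply,
      Matrix.mulVec, dotProduct, smul_eq_mul] at h2
    have h3 : PowerSeries.coeff n (PowerSeries.X * PowerSeries.derivative ℂ (T i))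
        = n * y n i := by
      cases n with
      | zero => simp
      | succ n =>
        rw [PowerSeries.coeff_succ_X_mul, PowerSeries.coeff_derivative, PowerSeries.coeff_mk]
        push_cast; ring
    rw [map_add, h3, smul_eq_mul, PowerSeries.coeff_C_mul, PowerSeries.coeff_mk, ← h2, map_sum]
    congr 1
    simp only [map_smul, Finsupp.smul_apply, smul_eq_mul, PowerSeries.coeff_mul]
    rw [Finset.sum_comm, Finset.Nat.sum_antidiagonal_eq_sum_range_succ_mk, Finset.sum_range_succ,
      Nat.sub_self]
    simp only [A, T, Matrix.of_apply, PowerSeries.coeff_mk, mul_comm]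

end Eigenvector

/-! ### Regular modules and simple pole lattices -/

section Lattice

theorem isUnit_or_X_dvd (S : ℂ⟦X⟧) : IsUnit S ∨ PowerSeries.X ∣ S := by
  rw [PowerSeries.isUnit_iff_constantCoeff, PowerSeries.X_dvd_iff, isUnit_iff_ne_zero]
  exact ne_or_eq _ _

/-- A submodule stable under division by `b` is stable under division by any nonzero power
series. -/
theorem mem_of_smul_mem {E : Type u} [AddCommGroup E] [Module ℂ⟦X⟧ E] {G : Submodule ℂ⟦X⟧ E}
    (hG : ∀ x, (PowerSeries.X : ℂ⟦X⟧) • x ∈ G → x ∈ G) {S : ℂ⟦X⟧} (hS : S ≠ 0) {x : E}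
    (h : S • x ∈ G) : x ∈ G := by
  have hpow : ∀ n : ℕ, (PowerSeries.X ^ n : ℂ⟦X⟧) • x ∈ G → x ∈ G := by
    intro n
    induction n with
    | zero => intro h; rwa [pow_zero, one_smul] at h
    | succ n ih => intro h; rw [pow_succ', mul_smul] at h; exact ih (hG _ h)
  obtain ⟨V, hV⟩ := PowerSeries.isUnit_divided_by_X_pow_order hS
  refine hpow S.order.toNat ?_
  rw [← PowerSeries.X_pow_order_mul_divXPowOrder (f := S), ← hV, mul_comm, mul_smul] at h
  have := G.smul_mem (↑V⁻¹ : ℂ⟦X⟧) h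
  rwa [smul_smul, Units.inv_mul, one_smul] at this

theorem isTorsionFree_quotient {E : Type u} [AddCommGroup E] [Module ℂ⟦X⟧ E] {G : Submodule ℂ⟦X⟧ E}
    (hG : ∀ x, (PowerSeries.X : ℂ⟦X⟧) • x ∈ G → x ∈ G) : Module.IsTorsionFree ℂ⟦X⟧ (E ⧸ G) := by
  rw [Module.isTorsionFree_iff_smul_eq_zero]
  intro S x hSx
  obtain ⟨x, rfl⟩ := Submodule.Quotient.mk_surjective _ x
  by_cases hS : S = 0
  · exact Or.inl hS
  · refine Or.inr ((Submodule.Quotient.mk_eq_zero _).2 (mem_of_smul_mem hG hS ?_))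
    rwa [← Submodule.Quotient.mk_smul, Submodule.Quotient.mk_eq_zero] at hSx

variable (E : Type u) [AddCommGroup E] [Module ℂ⟦X⟧ E] [ABStructure E]

/-- `E` contains a lattice with a simple pole, i.e. a submodule `L` with `b^N E ⊆ L` for some `N`
and `a L ⊆ b L`.  This form of regularity passes to quotients. -/
def HasSimplePoleLattice : Prop :=
  ∃ (L : Submodule ℂ⟦X⟧ E) (N : ℕ), (∀ x, (PowerSeries.X ^ N : ℂ⟦X⟧) • x ∈ L) ∧
    ∀ x ∈ L, ∃ y ∈ L, aOp E x = (PowerSeries.X : ℂ⟦X⟧) • y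

variable {E}

theorem HasSimplePoleLattice.quotient (h : HasSimplePoleLattice E) (G : ABSubmodule E) :
    HasSimplePoleLattice (E ⧸ G.toSubmodule) := by
  obtain ⟨L, N, hN, hL⟩ := h
  refine ⟨L.map G.mkQ, N, fun x => ?_, ?_⟩
  · obtain ⟨x, rfl⟩ := Submodule.Quotient.mk_surjective _ x
    exact ⟨_, hN x, rfl⟩
  · rintro _ ⟨x, hx, rfl⟩
    obtain ⟨y, hy, hxy⟩ := hL x hx
    exact ⟨_, ⟨y, hy, rfl⟩, congrArg (Submodule.Quotient.mk (p := G.toSubmodule)) hxy⟩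

theorem aOp_X_pow_smul (n : ℕ) (x : E) :
    aOp E ((PowerSeries.X ^ n : ℂ⟦X⟧) • x) =
      (PowerSeries.X ^ n : ℂ⟦X⟧) • (aOp E x + ((n : ℂ⟦X⟧) * PowerSeries.X) • x) := by
  rw [aOp_smul, smul_add, smul_smul]
  congr 2
  rw [Derivation.leibniz_pow, PowerSeries.derivative_X, nsmul_eq_mul, smul_eq_mul, mul_one]
  cases n with
  | zero => simp
  | succ n => rw [Nat.add_sub_cancel]; ring

/-- In a simple pole module containing `E`, the vectors with a multiple `b^n x` in `E` form a
module of finite type with a simple pole, so a common power of `b` sends it into `E`. -/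
theorem IsRegularAB.hasSimplePoleLattice (h : IsRegularAB E) : HasSimplePoleLattice E := by
  obtain ⟨E', _, _, _, f, hE', hpole, hf, hfa⟩ := h
  have := hE'.free
  have := hE'.finite
  have hcancel : ∀ (n : ℕ) {x y : E'}, (PowerSeries.X ^ n : ℂ⟦X⟧) • x =
      (PowerSeries.X ^ n : ℂ⟦X⟧) • y → x = y := fun n x y hxy =>
    smul_right_injective E' (pow_ne_zero n PowerSeries.X_ne_zero) hxy
  let P : Submodule ℂ⟦X⟧ E' :=
    { carrier := {x | ∃ n : ℕ, (PowerSeries.X ^ n : ℂ⟦X⟧) • x ∈ LinearMap.range f}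
      zero_mem' := ⟨0, by rw [smul_zero]; exact zero_mem _⟩
      add_mem' := by
        rintro x y ⟨m, hm⟩ ⟨n, hn⟩
        refine ⟨m + n, ?_⟩
        rw [smul_add]
        refine add_mem ?_ ?_
        · rw [add_comm, pow_add, mul_smul]; exact Submodule.smul_mem _ _ hm
        · rw [pow_add, mul_smul]; exact Submodule.smul_mem _ _ hn
      smul_mem' := by
        rintro S x ⟨n, hn⟩
        exact ⟨n, by rw [smul_comm]; exact Submodule.smul_mem _ _ hn⟩ }
  have hP : ∀ x ∈ P, ∃ y ∈ P, aOp E' x = (PowerSeries.X : ℂ⟦X⟧) • y := by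
    rintro x ⟨n, z, hz⟩
    obtain ⟨y, -, hy⟩ := hpole x
    refine ⟨y, ⟨n + 1, aOp E z - ((n : ℂ⟦X⟧) * PowerSeries.X) • z, ?_⟩, hy.symm⟩
    replace hy : (PowerSeries.X : ℂ⟦X⟧) • y = aOp E' x := hy
    rw [map_sub, hfa, map_smul, hz, aOp_X_pow_smul, smul_add, smul_comm _ _ x,
      add_sub_cancel_right, pow_succ, mul_smul, hy]
  obtain ⟨N, hN⟩ : ∃ N : ℕ, ∀ x ∈ P, (PowerSeries.X ^ N : ℂ⟦X⟧) • x ∈ LinearMap.range f := by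
    obtain ⟨s, hs⟩ := (IsNoetherian.noetherian P : P.FG)
    have hsP : ∀ x ∈ s, x ∈ P := fun x hx => hs ▸ Submodule.subset_span hx
    choose! n hn using (fun x hx => hsP x hx : ∀ x ∈ s,
      ∃ n : ℕ, (PowerSeries.X ^ n : ℂ⟦X⟧) • x ∈ LinearMap.range f)
    refine ⟨s.sup n, fun x hx => ?_⟩
    have : P ≤ (LinearMap.range f).comap
        (LinearMap.lsmul ℂ⟦X⟧ E' (PowerSeries.X ^ s.sup n : ℂ⟦X⟧)) := by
      rw [← hs, Submodule.span_le]
      intro y hy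
      rw [SetLike.mem_coe, Submodule.mem_comap, LinearMap.lsmul_apply,
        ← Nat.sub_add_cancel (Finset.le_sup (f := n) hy), pow_add, mul_smul]
      exact Submodule.smul_mem _ _ (hn y hy)
    exact this hx
  refine ⟨(P.map (LinearMap.lsmul ℂ⟦X⟧ E' (PowerSeries.X ^ N : ℂ⟦X⟧))).comap f, N, fun x => ?_, ?_⟩
  · exact ⟨f x, ⟨0, x, by rw [pow_zero, one_smul]⟩, by rw [LinearMap.lsmul_apply, map_smul]⟩
  · rintro x ⟨y, hy, hyx⟩
    rw [LinearMap.lsmul_apply] at hyx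
    obtain ⟨w, hw, hyw⟩ := hP y hy
    have hw' : w + (N : ℂ⟦X⟧) • y ∈ P := add_mem hw (P.smul_mem _ hy)
    obtain ⟨z, hz⟩ := hN _ hw'
    refine ⟨z, ⟨_, hw', hz.symm⟩, hf ?_⟩
    rw [hfa, map_smul, hz, ← hyx, aOp_X_pow_smul, hyw, smul_comm _ _ (w + _), smul_add _ w,
      smul_smul _ _ y, mul_comm (N : ℂ⟦X⟧)]

/-- A nonzero regular module contains a vector `x` with `a x = λ b x` generating a normal
submodule. -/
theorem HasSimplePoleLattice.exists_normal_eigenvector [Module.Finite ℂ⟦X⟧ E]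
    [Module.IsTorsionFree ℂ⟦X⟧ E] [Nontrivial E] (h : HasSimplePoleLattice E) :
    ∃ (lam : ℂ) (x : E), x ≠ 0 ∧ aSub E lam x = 0 ∧
      ∀ y, (PowerSeries.X : ℂ⟦X⟧) • y ∈ Submodule.span ℂ⟦X⟧ {x} →
        y ∈ Submodule.span ℂ⟦X⟧ {x} := by
  obtain ⟨L, N, hN, hL⟩ := h
  have hX : Function.Injective fun x : E => (PowerSeries.X : ℂ⟦X⟧) • x :=
    smul_right_injective E PowerSeries.X_ne_zero
  have hne : ∃ (x : E) (lam : ℂ), x ≠ 0 ∧ aSub E lam x = 0 := by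
    have : Nontrivial L := by
      obtain ⟨x, hx⟩ := exists_ne (0 : E)
      refine ⟨⟨_, hN x⟩, 0, fun h0 => hx ?_⟩
      refine (smul_right_injective E (pow_ne_zero N PowerSeries.X_ne_zero :
        (PowerSeries.X ^ N : ℂ⟦X⟧) ≠ 0)) ?_
      simpa using congrArg Subtype.val h0
    choose g hg using fun x : L => hL x x.2
    let θ : L →+ L := AddMonoidHom.mk' (fun x => ⟨g x, (hg x).1⟩) fun x y => by
      refine Subtype.ext (hX ?_)
      change (PowerSeries.X : ℂ⟦X⟧) • g (x + y) = (PowerSeries.X : ℂ⟦X⟧) • (g x + g y)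
      rw [smul_add, ← (hg _).2, ← (hg _).2, ← (hg _).2, ← map_add]
      rfl
    obtain ⟨lam, x, hx, hxl⟩ := exists_eigenvector θ fun S x => by
      refine Subtype.ext (hX ?_)
      change (PowerSeries.X : ℂ⟦X⟧) • g (S • x) = (PowerSeries.X : ℂ⟦X⟧) • (S • g x
        + (PowerSeries.X * PowerSeries.derivative ℂ S) • (x : E))
      rw [← (hg _).2, smul_add, smul_comm _ S, ← (hg _).2, smul_smul, ← mul_assoc, ← pow_two]
      exact aOp_smul S (x : E)
    refine ⟨x, lam, fun h0 => hx (Subtype.ext h0), ?_⟩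
    rw [aSub_apply, (hg x).2, mul_comm, mul_smul, sub_eq_zero]
    exact congrArg (fun z : L => (PowerSeries.X : ℂ⟦X⟧) • (z : E)) hxl
  -- A maximal submodule generated by an eigenvector is stable under division by `b`, because
  -- `b⁻¹` times an eigenvector for `λ` is one for `λ - 1`.
  obtain ⟨M, ⟨x, lam, hx, hlam, rfl⟩, hmax⟩ := set_has_maximal_iff_noetherian.2
    (inferInstance : IsNoetherian ℂ⟦X⟧ E)
    {M | ∃ (x : E) (lam : ℂ), x ≠ 0 ∧ aSub E lam x = 0 ∧ M = Submodule.span ℂ⟦X⟧ {x}}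
    (by obtain ⟨x, lam, hx, h⟩ := hne; exact ⟨_, x, lam, hx, h, rfl⟩)
  refine ⟨lam, x, hx, hlam, fun z hz => ?_⟩
  obtain ⟨S, hS⟩ := Submodule.mem_span_singleton.1 hz
  rcases isUnit_or_X_dvd S with ⟨V, rfl⟩ | ⟨S', rfl⟩
  · set w : E := (↑V⁻¹ : ℂ⟦X⟧) • z with hw
    have hxw : x = (PowerSeries.X : ℂ⟦X⟧) • w := by
      rw [hw, smul_comm, ← hS, smul_smul, Units.inv_mul, one_smul]
    have hzw : z = (V : ℂ⟦X⟧) • w := by rw [hw, smul_smul, Units.mul_inv, one_smul]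
    have haw : aSub E (lam - 1) w = 0 := by
      rw [hxw, aSub_smul (lam - 1)] at hlam
      have h0 : rankOneA (lam - 1 - lam) (PowerSeries.X : ℂ⟦X⟧) = 0 := by
        rw [rankOneA_apply, PowerSeries.derivative_X, show lam - 1 - lam = -1 by ring]
        rw [map_neg, map_one]; ring
      rw [h0, zero_smul, add_zero] at hlam
      exact hX (by simpa using hlam)
    have hle : Submodule.span ℂ⟦X⟧ {x} ≤ Submodule.span ℂ⟦X⟧ {w} := by
      rw [Submodule.span_singleton_le_iff_mem, hxw]
      exact Submodule.smul_mem _ _ (Submodule.mem_span_singleton_self _)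
    have hw0 : w ≠ 0 := fun h0 => hx (by rw [hxw, h0, smul_zero])
    have heq := eq_of_le_of_not_lt hle (hmax _ ⟨w, lam - 1, hw0, haw, rfl⟩)
    rw [heq, hzw]
    exact Submodule.smul_mem _ _ (Submodule.mem_span_singleton_self _)
  · refine Submodule.mem_span_singleton.2 ⟨S', hX ?_⟩
    change (PowerSeries.X : ℂ⟦X⟧) • S' • x = (PowerSeries.X : ℂ⟦X⟧) • z
    rw [← hS, mul_smul]

end Lattice

/-! ### Triangular bases -/

section Triangular

variable {E : Type u} [AddCommGroup E] [Module ℂ⟦X⟧ E] [ABStructure E]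

/-- The vectors `e 0, …, e (n - 1)` are linearly independent and `a` is triangular on their span,
with diagonal entries `λ_j b`.  Independence is stated one step at a time. -/
structure IsTriangular (n : ℕ) (e : ℕ → E) (lam : ℕ → ℂ) : Prop where
  op : ∀ j < n, aSub E (lam j) (e j) ∈ flagSpan e j
  indep : ∀ j < n, ∀ S : ℂ⟦X⟧, S • e j ∈ flagSpan e j → S = 0

theorem IsTriangular.aOp_mem {n : ℕ} {e : ℕ → E} {lam : ℕ → ℂ} (h : IsTriangular n e lam) {j : ℕ}
    (hj : j ≤ n) {x : E} (hx : x ∈ flagSpan e j) : aOp E x ∈ flagSpan e j := by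
  induction j generalizing x with
  | zero =>
    rw [flagSpan_zero, Submodule.mem_bot] at hx ⊢
    rw [hx, map_zero]
  | succ j ih =>
    obtain ⟨S, y, hy, rfl⟩ := mem_flagSpan_succ.1 hx
    have hle := flagSpan_mono e (Nat.le_succ j)
    have hej := mem_flagSpan e (Nat.lt_succ_self j)
    rw [map_add, aOp_smul, aOp_eq (lam j)]
    exact add_mem (add_mem (Submodule.smul_mem _ _ (add_mem (Submodule.smul_mem _ _ hej)
      (hle (h.op j hj)))) (Submodule.smul_mem _ _ hej)) (hle (ih (by omega) hy))

theorem IsTriangular.aSub_mem {n : ℕ} {e : ℕ → E} {lam : ℕ → ℂ} (h : IsTriangular n e lam) {j : ℕ}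
    (hj : j ≤ n) (mu : ℂ) {x : E} (hx : x ∈ flagSpan e j) : aSub E mu x ∈ flagSpan e j := by
  rw [aSub_apply]
  exact sub_mem (h.aOp_mem hj hx) (Submodule.smul_mem _ _ hx)

/-- A step of the flag of a triangular system, as a submodule stable by `a`. -/
noncomputable def IsTriangular.flag {n : ℕ} {e : ℕ → E} {lam : ℕ → ℂ} (h : IsTriangular n e lam)
    {j : ℕ} (hj : j ≤ n) : ABSubmodule E where
  toSubmodule := flagSpan e j
  a_mem _ hx := h.aOp_mem hj hx

/-- A triangular system spanning a proper submodule stable under division by `b` can be extended by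
a lift of an eigenvector of the quotient. -/
theorem exists_triangular_succ [Module.Finite ℂ⟦X⟧ E] (h : HasSimplePoleLattice E) {n : ℕ}
    {e : ℕ → E} {lam : ℕ → ℂ} (ht : IsTriangular n e lam)
    (hG : ∀ x, (PowerSeries.X : ℂ⟦X⟧) • x ∈ flagSpan e n → x ∈ flagSpan e n)
    (hne : flagSpan e n ≠ ⊤) :
    ∃ (e' : ℕ → E) (lam' : ℕ → ℂ), IsTriangular (n + 1) e' lam' ∧
      ∀ x, (PowerSeries.X : ℂ⟦X⟧) • x ∈ flagSpan e' (n + 1) → x ∈ flagSpan e' (n + 1) := by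
  let G := ht.flag le_rfl
  have : Module.IsTorsionFree ℂ⟦X⟧ (E ⧸ G.toSubmodule) := isTorsionFree_quotient hG
  have : Nontrivial (E ⧸ G.toSubmodule) := Submodule.Quotient.nontrivial_iff.2 hne
  obtain ⟨mu, x, hx0, hax, hx⟩ := (h.quotient G).exists_normal_eigenvector
  obtain ⟨x, rfl⟩ := Submodule.Quotient.mk_surjective _ x
  have hfl : ∀ j ≤ n, flagSpan (Function.update e n x) j = flagSpan e j := fun j hj =>
    flagSpan_congr' fun i hi => Function.update_of_ne (by omega) _ _
  refine ⟨Function.update e n x, Function.update lam n mu, ⟨fun j hj => ?_, fun j hj S hS => ?_⟩,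
    fun y hy => ?_⟩
  · rw [hfl j (by omega)]
    rcases Nat.lt_succ_iff_lt_or_eq.1 hj with hj | rfl
    · rw [Function.update_of_ne hj.ne, Function.update_of_ne hj.ne]
      exact ht.op j hj
    · rw [Function.update_self, Function.update_self]
      exact (Submodule.Quotient.mk_eq_zero (flagSpan e j)).1 hax
  · rw [hfl j (by omega)] at hS
    rcases Nat.lt_succ_iff_lt_or_eq.1 hj with hj | rfl
    · rw [Function.update_of_ne hj.ne] at hS
      exact ht.indep j hj S hS
    · rw [Function.update_self] at hS
      by_contra hS0
      exact hx0 ((Submodule.Quotient.mk_eq_zero _).2 (mem_of_smul_mem hG hS0 hS))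
  · have key : ∀ z : E, z ∈ flagSpan (Function.update e n x) (n + 1) ↔
        (Submodule.Quotient.mk z : E ⧸ flagSpan e n) ∈
          Submodule.span ℂ⟦X⟧ {(Submodule.Quotient.mk x : E ⧸ flagSpan e n)} := by
      intro z
      rw [mem_flagSpan_succ, Submodule.mem_span_singleton, hfl n le_rfl, Function.update_self]
      refine exists_congr fun S => ?_
      rw [← Submodule.Quotient.mk_smul, eq_comm, Submodule.Quotient.eq]
      exact ⟨fun ⟨g, hg, h⟩ => by rw [h, add_sub_cancel_left]; exact hg,
        fun hg => ⟨_, hg, by abel⟩⟩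
    rw [key] at hy ⊢
    exact hx _ hy

/-- A regular module has a basis in which `a` is triangular: otherwise the flag could be extended
beyond the rank of `E`. -/
theorem exists_triangular [Module.Free ℂ⟦X⟧ E] [Module.Finite ℂ⟦X⟧ E]
    (h : HasSimplePoleLattice E) :
    ∃ (e : ℕ → E) (lam : ℕ → ℂ), IsTriangular (Module.finrank ℂ⟦X⟧ E) e lam ∧
      flagSpan e (Module.finrank ℂ⟦X⟧ E) = ⊤ := by
  have hrank : ∀ (n : ℕ) (e : ℕ → E) (lam : ℕ → ℂ), IsTriangular n e lam →
      n ≤ Module.finrank ℂ⟦X⟧ E := fun n e lam ht => by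
    simpa using (linearIndependent_of_flag ht.indep).fintype_card_le_finrank
  by_contra hc
  have hall : ∀ n : ℕ, ∃ (e : ℕ → E) (lam : ℕ → ℂ), IsTriangular n e lam ∧
      ∀ x, (PowerSeries.X : ℂ⟦X⟧) • x ∈ flagSpan e n → x ∈ flagSpan e n := by
    intro n
    induction n with
    | zero =>
      refine ⟨0, 0, ⟨fun j hj => by omega, fun j hj => by omega⟩, fun x hx => ?_⟩
      rw [flagSpan_zero, Submodule.mem_bot] at hx ⊢
      exact (smul_eq_zero.1 hx).resolve_left PowerSeries.X_ne_zero
    | succ n ih =>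
      obtain ⟨e, lam, ht, hG⟩ := ih
      refine exists_triangular_succ h ht hG fun htop => hc ?_
      have hn : Module.finrank ℂ⟦X⟧ E = n := by
        refine le_antisymm ?_ (hrank n e lam ht)
        have : Set.range (fun j : Fin n => e j) = e '' Set.Iio n := by
          ext x; simp [Fin.exists_iff]
        have hspan : ⊤ ≤ Submodule.span ℂ⟦X⟧ (Set.range fun j : Fin n => e j) := by
          rw [this]; exact htop.ge
        rw [Module.finrank_eq_card_basis
          (Module.Basis.mk (linearIndependent_of_flag ht.indep) hspan), Fintype.card_fin]
      exact ⟨e, lam, hn ▸ ht, hn ▸ htop⟩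
  obtain ⟨e, lam, ht, -⟩ := hall (Module.finrank ℂ⟦X⟧ E + 1)
  exact absurd (hrank _ _ _ ht) (by omega)

end Triangular

/-! ### The normal form of a module generated by one element -/

section Chain

variable {E : Type u} [AddCommGroup E] [Module ℂ⟦X⟧ E] [ABStructure E]

/-- A triangular system in normal form: `(a - λ_0 b) e_0 = 0` and
`(a - λ_{j+1} b) e_{j+1} = U_j e_j` with `U_j` invertible. -/
structure IsABChain (n : ℕ) (e : ℕ → E) (lam : ℕ → ℂ) (U : ℕ → ℂ⟦X⟧ˣ) : Prop where
  op_zero : 0 < n → aSub E (lam 0) (e 0) = 0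
  op_succ : ∀ j, j + 1 < n → aSub E (lam (j + 1)) (e (j + 1)) = (U j : ℂ⟦X⟧) • e j
  indep : ∀ j < n, ∀ S : ℂ⟦X⟧, S • e j ∈ flagSpan e j → S = 0

theorem IsABChain.isTriangular {n : ℕ} {e : ℕ → E} {lam : ℕ → ℂ} {U : ℕ → ℂ⟦X⟧ˣ}
    (h : IsABChain n e lam U) : IsTriangular n e lam where
  op j hj := by
    cases j with
    | zero => rw [h.op_zero hj]; exact zero_mem _
    | succ j => rw [h.op_succ j hj]; exact Submodule.smul_mem _ _ (mem_flagSpan e (by omega))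
  indep := h.indep

/-- `g` generates `G`: it belongs to `G`, and to no smaller submodule stable by `a`. -/
def ABGenerates (G : Submodule ℂ⟦X⟧ E) (g : E) : Prop :=
  g ∈ G ∧ ∀ H : ABSubmodule E, g ∈ H.toSubmodule → G ≤ H.toSubmodule

/-- The submodule `ℂ⟦b⟧ x + K`, where `a x - λ b x ∈ K`. -/
noncomputable def ABSubmodule.adjoin (K : ABSubmodule E) {lam : ℂ} {x : E}
    (hx : aSub E lam x ∈ K.toSubmodule) : ABSubmodule E where
  toSubmodule := Submodule.span ℂ⟦X⟧ {x} ⊔ K.toSubmodule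
  a_mem y hy := by
    obtain ⟨z, hz, w, hw, rfl⟩ := Submodule.mem_sup.1 hy
    obtain ⟨S, rfl⟩ := Submodule.mem_span_singleton.1 hz
    have hmem : x ∈ Submodule.span ℂ⟦X⟧ {x} ⊔ K.toSubmodule :=
      Submodule.mem_sup_left (Submodule.mem_span_singleton_self x)
    rw [map_add, aOp_smul, aOp_eq lam]
    exact add_mem (add_mem (Submodule.smul_mem _ _ (add_mem (Submodule.smul_mem _ _ hmem)
      (Submodule.mem_sup_right hx))) (Submodule.smul_mem _ _ hmem))
      (Submodule.mem_sup_right (K.a_mem w hw))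

theorem rankOneA_neg_one_X : rankOneA (-1) (PowerSeries.X : ℂ⟦X⟧) = 0 := by
  rw [rankOneA_apply, PowerSeries.derivative_X, map_neg, map_one]; ring

theorem aSub_add_one_X_smul (lam : ℂ) (x : E) :
    aSub E (lam + 1) ((PowerSeries.X : ℂ⟦X⟧) • x) = (PowerSeries.X : ℂ⟦X⟧) • aSub E lam x := by
  rw [aSub_smul lam, show lam - (lam + 1) = -1 by ring, rankOneA_neg_one_X, zero_smul, add_zero]

/-- A generator of a step of the flag is, up to a unit, congruent to `e j` modulo the preceding
step, and applying `a - λ_j b` to it then gives a generator of the preceding step. -/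
theorem IsTriangular.generates_pred {n : ℕ} {e : ℕ → E} {lam : ℕ → ℂ} (ht : IsTriangular n e lam)
    {j : ℕ} (hj : j < n) {g : E} (hg : ABGenerates (flagSpan e (j + 1)) g) :
    ∃ (U : ℂ⟦X⟧ˣ) (x : E), g = (U : ℂ⟦X⟧) • x ∧ x - e j ∈ flagSpan e j ∧
      ABGenerates (flagSpan e j) (aSub E (lam j) x) := by
  obtain ⟨S, y, hy, rfl⟩ := mem_flagSpan_succ.1 hg.1
  have hS : IsUnit S := by
    rcases isUnit_or_X_dvd S with h | ⟨S', rfl⟩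
    · exact h
    -- In this case `g` lies in the smaller submodule `ℂ⟦b⟧ b e_j + G_j`, where `G_j` is the
    -- preceding step.
    · have hx : aSub E (lam j + 1) ((PowerSeries.X : ℂ⟦X⟧) • e j) ∈
          (ht.flag hj.le).toSubmodule := by
        rw [aSub_add_one_X_smul]; exact Submodule.smul_mem _ _ (ht.op j hj)
      have hmem := hg.2 ((ht.flag hj.le).adjoin hx) (by
        refine add_mem (Submodule.mem_sup_left ?_) (Submodule.mem_sup_right hy)
        rw [mul_comm, mul_smul]
        exact Submodule.smul_mem _ _ (Submodule.mem_span_singleton_self _))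
        (mem_flagSpan e (Nat.lt_succ_self j))
      obtain ⟨z, hz, w, hw, hzw⟩ := Submodule.mem_sup.1 hmem
      obtain ⟨R, rfl⟩ := Submodule.mem_span_singleton.1 hz
      have h0 := ht.indep j hj (1 - R * PowerSeries.X) (by
        rw [sub_smul, one_smul, mul_smul, sub_eq_of_eq_add' hzw.symm]
        exact hw)
      have := congrArg PowerSeries.constantCoeff h0
      simp at this
  obtain ⟨U, rfl⟩ := hS
  set x : E := e j + (↑U⁻¹ : ℂ⟦X⟧) • y with hx
  have hxe : x - e j ∈ flagSpan e j := by
    rw [hx, add_sub_cancel_left]; exact Submodule.smul_mem _ _ hy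
  have hgx : (U : ℂ⟦X⟧) • e j + y = (U : ℂ⟦X⟧) • x := by
    rw [hx, smul_add, smul_smul, Units.mul_inv, one_smul]
  have hax : aSub E (lam j) x ∈ flagSpan e j := by
    rw [hx, map_add]
    exact add_mem (ht.op j hj) (ht.aSub_mem hj.le _ (Submodule.smul_mem _ _ hy))
  refine ⟨U, x, hgx, hxe, hax, fun H hH w hw => ?_⟩
  -- If `H` contains `(a - λ_j b) x`, then `ℂ⟦b⟧ x + (H ∩ G_j)` is stable by `a` and contains `g`.
  let K : ABSubmodule E :=
    { toSubmodule := H.toSubmodule ⊓ flagSpan e j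
      a_mem := fun z hz => ⟨H.a_mem z hz.1, ht.aOp_mem hj.le hz.2⟩ }
  have hxK : aSub E (lam j) x ∈ K.toSubmodule := ⟨hH, hax⟩
  have hmem := hg.2 (K.adjoin hxK) (by
    rw [hgx]
    exact Submodule.mem_sup_left (Submodule.smul_mem _ _ (Submodule.mem_span_singleton_self _)))
    (flagSpan_mono e (Nat.le_succ j) hw)
  obtain ⟨z, hz, w', hw', rfl⟩ := Submodule.mem_sup.1 hmem
  obtain ⟨R, rfl⟩ := Submodule.mem_span_singleton.1 hz
  have hR : R = 0 := ht.indep j hj R (by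
    have h1 : R • e j = R • x + w' - w' - R • (x - e j) := by rw [smul_sub]; abel
    rw [h1]
    exact sub_mem (sub_mem hw hw'.2) (Submodule.smul_mem _ _ hxe))
  rw [hR, zero_smul, zero_add]
  exact hw'.1

/-- The normal form, together with its relation to a given generator `g` of the step `j` of the
flag: `g` is a unit times the last vector. -/
theorem IsTriangular.exists_chain_aux {n : ℕ} {e : ℕ → E} {lam : ℕ → ℂ}
    (ht : IsTriangular n e lam) {j : ℕ} (hj : j ≤ n) {g : E}
    (hg : ABGenerates (flagSpan e j) g) :
    ∃ (e' : ℕ → E) (U : ℕ → ℂ⟦X⟧ˣ), (∀ i < j, e' i - e i ∈ flagSpan e i) ∧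
      (∀ i, i + 1 = j → g = (U i : ℂ⟦X⟧) • e' i) ∧
      (0 < j → aSub E (lam 0) (e' 0) = 0) ∧
      ∀ i, i + 1 < j → aSub E (lam (i + 1)) (e' (i + 1)) = (U i : ℂ⟦X⟧) • e' i := by
  induction j generalizing g with
  | zero => exact ⟨e, 1, fun i hi => by omega, fun i hi => by omega, fun h => by omega,
      fun i hi => by omega⟩
  | succ j ih =>
    obtain ⟨V, x, hgx, hxe, hgen⟩ := ht.generates_pred hj hg
    obtain ⟨e', U, h1, h2, h3, h4⟩ := ih (by omega) hgen
    refine ⟨Function.update e' j x, Function.update U j V, fun i hi => ?_, fun i hi => ?_,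
      fun _ => ?_, fun i hi => ?_⟩
    · rcases Nat.lt_succ_iff_lt_or_eq.1 hi with hi | rfl
      · rw [Function.update_of_ne hi.ne]; exact h1 i hi
      · rw [Function.update_self]; exact hxe
    · obtain rfl : i = j := by omega
      rw [Function.update_self, Function.update_self, hgx]
    · rcases Nat.eq_zero_or_pos j with rfl | hj
      · rw [Function.update_self]
        have := hgen.1
        rwa [flagSpan_zero, Submodule.mem_bot] at this
      · rw [Function.update_of_ne hj.ne]; exact h3 hj
    · have hij : i ≠ j := by omega
      rw [Function.update_of_ne hij, Function.update_of_ne hij]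
      rcases Nat.lt_succ_iff_lt_or_eq.1 hi with hi | hi
      · rw [Function.update_of_ne hi.ne]; exact h4 i hi
      · rw [hi, Function.update_self]; exact h2 i hi

/-- In a module generated by one element, a triangular basis can be modified, without changing
its flag, so that it is in normal form. -/
theorem IsTriangular.exists_chain {n : ℕ} {e : ℕ → E} {lam : ℕ → ℂ} (ht : IsTriangular n e lam)
    {g : E} (hg : ABGenerates (flagSpan e n) g) :
    ∃ (e' : ℕ → E) (U : ℕ → ℂ⟦X⟧ˣ), IsABChain n e' lam U ∧
      ∀ i < n, e' i - e i ∈ flagSpan e i := by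
  obtain ⟨e', U, h1, -, h3, h4⟩ := ht.exists_chain_aux le_rfl hg
  refine ⟨e', U, ⟨h3, h4, fun j hj S hS => ht.indep j hj S ?_⟩, h1⟩
  rw [flagSpan_congr fun i hi => h1 i (hi.trans hj)] at hS
  have : S • e j = S • e' j - S • (e' j - e j) := by rw [smul_sub]; abel
  rw [this]
  exact sub_mem hS (Submodule.smul_mem _ _ (h1 j hj))

end Chain

/-! ### Exchange of two consecutive rank one quotients -/

section Swap

variable {E : Type u} [AddCommGroup E] [Module ℂ⟦X⟧ E] [ABStructure E]

theorem rankOneA_inv {δ : ℂ} {T V U : ℂ⟦X⟧} (hTV : T * V = 1)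
    (hT : rankOneA δ T = PowerSeries.X * -U) :
    rankOneA (-δ) V = PowerSeries.X * U * V ^ 2 := by
  have h2 := congrArg (PowerSeries.derivative ℂ) hTV
  rw [Derivation.leibniz, Derivation.map_one_eq_zero, smul_eq_mul, smul_eq_mul] at h2
  rw [rankOneA_apply] at hT ⊢
  rw [map_neg]
  linear_combination (PowerSeries.X ^ 2 * V) * h2 - V ^ 2 * hT
    - (PowerSeries.X ^ 2 * PowerSeries.derivative ℂ V - PowerSeries.C δ * PowerSeries.X * V) * hTV

/-- Exchange of two consecutive rank one quotients: when the extension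
`(a - λ_{i+1} b) e_{i+1} ≡ U e_i` is such that `λ_i - λ_{i+1} - 1` is not an integer `≤ 0`, the
differential equation `b T' + (λ_i - λ_{i+1} - 1) T = -U` has an invertible solution, and
`b e_{i+1} + T e_i` is an eigenvector modulo the preceding vectors. -/
theorem IsTriangular.exists_swap {n : ℕ} {e : ℕ → E} {lam : ℕ → ℂ} (ht : IsTriangular n e lam)
    {i : ℕ} (hi : i + 1 < n) {U : ℂ⟦X⟧ˣ}
    (hU : aSub E (lam (i + 1)) (e (i + 1)) - (U : ℂ⟦X⟧) • e i ∈ flagSpan e i)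
    (hδ : ∀ m : ℕ, (m : ℂ) + (lam i - lam (i + 1) - 1) ≠ 0) :
    ∃ e' : ℕ → E, IsTriangular n e'
        (Function.update (Function.update lam i (lam (i + 1) + 1)) (i + 1) (lam i - 1)) ∧
      flagSpan e' n = flagSpan e n := by
  obtain ⟨T, hT⟩ := exists_rankOneA_eq hδ (-(U : ℂ⟦X⟧))
  obtain ⟨V, rfl⟩ : IsUnit T := by
    rw [PowerSeries.isUnit_iff_constantCoeff, isUnit_iff_ne_zero]
    intro h0
    have h1 := congrArg (PowerSeries.coeff 1) hT
    rw [coeff_succ_rankOneA, PowerSeries.coeff_zero_eq_constantCoeff_apply, h0, mul_zero,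
      PowerSeries.coeff_succ_X_mul, PowerSeries.coeff_zero_eq_constantCoeff_apply, map_neg,
      eq_comm, neg_eq_zero] at h1
    exact (PowerSeries.isUnit_iff_constantCoeff.1 U.isUnit).ne_zero h1
  set p : E := (PowerSeries.X : ℂ⟦X⟧) • e (i + 1) + (V : ℂ⟦X⟧) • e i with hp
  set q : E := (↑V⁻¹ : ℂ⟦X⟧) • e (i + 1) with hq
  set e' : ℕ → E := Function.update (Function.update e i p) (i + 1) q with he'
  have hne : i ≠ i + 1 := by omega
  have he'i : e' i = p := by rw [he', Function.update_of_ne hne, Function.update_self]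
  have he'i1 : e' (i + 1) = q := by rw [he', Function.update_self]
  have he'j : ∀ j, j ≠ i → j ≠ i + 1 → e' j = e j := fun j h1 h2 => by
    rw [he', Function.update_of_ne h2, Function.update_of_ne h1]
  have hlow : ∀ j ≤ i, flagSpan e' j = flagSpan e j := fun j hj =>
    flagSpan_congr' fun m hm => he'j m (by omega) (by omega)
  have hei1 : e i = (↑V⁻¹ : ℂ⟦X⟧) • p - (PowerSeries.X : ℂ⟦X⟧) • q := by
    rw [hp, hq, smul_add, smul_smul (↑V⁻¹ : ℂ⟦X⟧) (V : ℂ⟦X⟧), Units.inv_mul, one_smul, smul_comm]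
    abel
  have heq : e (i + 1) = (V : ℂ⟦X⟧) • q := by rw [hq, smul_smul, Units.mul_inv, one_smul]
  have htop : ∀ d, flagSpan e' (i + 2 + d) = flagSpan e (i + 2 + d) := by
    intro d
    induction d with
    | zero =>
      have h1 : ∀ f : ℕ → E, ∀ G : Submodule ℂ⟦X⟧ E, flagSpan f i ≤ G → f i ∈ G → f (i + 1) ∈ G →
          flagSpan f (i + 2) ≤ G := by
        intro f G hG h1 h2
        rw [flagSpan_succ, flagSpan_succ]
        simp only [sup_le_iff, Submodule.span_singleton_le_iff_mem]
        exact ⟨h2, h1, hG⟩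
      have m1 : ∀ f : ℕ → E, f i ∈ flagSpan f (i + 2) := fun f => mem_flagSpan f (by omega)
      have m2 : ∀ f : ℕ → E, f (i + 1) ∈ flagSpan f (i + 2) := fun f => mem_flagSpan f (by omega)
      have hle : ∀ f : ℕ → E, flagSpan f i ≤ flagSpan f (i + 2) := fun f =>
        flagSpan_mono f (by omega)
      refine le_antisymm (h1 _ _ ?_ ?_ ?_) (h1 _ _ ?_ ?_ ?_)
      · rw [hlow i le_rfl]; exact hle e
      · rw [he'i]
        exact add_mem (Submodule.smul_mem _ _ (m2 e)) (Submodule.smul_mem _ _ (m1 e))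
      · rw [he'i1]; exact Submodule.smul_mem _ _ (m2 e)
      · rw [← hlow i le_rfl]; exact hle e'
      · rw [hei1, ← he'i, ← he'i1]
        exact sub_mem (Submodule.smul_mem _ _ (m1 e')) (Submodule.smul_mem _ _ (m2 e'))
      · rw [heq, ← he'i1]; exact Submodule.smul_mem _ _ (m2 e')
    | succ d ih =>
      rw [← add_assoc, flagSpan_succ, ih, flagSpan_succ, he'j _ (by omega) (by omega)]
  have htop' : ∀ j, i + 2 ≤ j → flagSpan e' j = flagSpan e j := fun j hj => by
    have := htop (j - (i + 2))
    rwa [Nat.add_sub_cancel' hj] at this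
  refine ⟨e', ⟨fun j hj => ?_, fun j hj S hS => ?_⟩, htop' n hi⟩
  · rcases eq_or_ne j i with rfl | hji
    · rw [he'i, Function.update_of_ne hne, Function.update_self, hlow j le_rfl, hp, map_add,
        aSub_add_one_X_smul, aSub_smul (lam j) _ (V : ℂ⟦X⟧),
        show lam j - (lam (j + 1) + 1) = lam j - lam (j + 1) - 1 by ring, hT]
      have hsplit : (PowerSeries.X : ℂ⟦X⟧) • aSub E (lam (j + 1)) (e (j + 1)) +
          ((V : ℂ⟦X⟧) • aSub E (lam j) (e j) + (PowerSeries.X * -(U : ℂ⟦X⟧)) • e j) =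
          (PowerSeries.X : ℂ⟦X⟧) • (aSub E (lam (j + 1)) (e (j + 1)) - (U : ℂ⟦X⟧) • e j)
            + (V : ℂ⟦X⟧) • aSub E (lam j) (e j) := by
        rw [smul_sub, mul_neg, neg_smul, mul_smul]; abel
      rw [hsplit]
      exact add_mem (Submodule.smul_mem _ _ hU) (Submodule.smul_mem _ _ (ht.op j hj))
    rcases eq_or_ne j (i + 1) with rfl | hji1
    · rw [he'i1, Function.update_self, hq, aSub_smul (lam (i + 1)),
        show lam (i + 1) - (lam i - 1) = -(lam i - lam (i + 1) - 1) by ring,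
        rankOneA_inv (Units.mul_inv V) hT]
      refine mem_flagSpan_succ.2 ⟨(U : ℂ⟦X⟧) * (↑V⁻¹ : ℂ⟦X⟧) ^ 2, (↑V⁻¹ : ℂ⟦X⟧) •
        (aSub E (lam (i + 1)) (e (i + 1)) - (U : ℂ⟦X⟧) • e i), ?_, ?_⟩
      · rw [hlow i le_rfl]; exact Submodule.smul_mem _ _ hU
      · have hV : (U : ℂ⟦X⟧) * (↑V⁻¹ : ℂ⟦X⟧) ^ 2 * (V : ℂ⟦X⟧) = (↑V⁻¹ : ℂ⟦X⟧) * (U : ℂ⟦X⟧) := by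
          rw [pow_two, mul_assoc, mul_assoc (↑V⁻¹ : ℂ⟦X⟧), Units.inv_mul, mul_one, mul_comm]
        rw [he'i, hp, smul_add, smul_smul _ (V : ℂ⟦X⟧), hV, smul_sub,
          smul_smul (↑V⁻¹ : ℂ⟦X⟧) (U : ℂ⟦X⟧), smul_smul _ (PowerSeries.X : ℂ⟦X⟧),
          mul_assoc PowerSeries.X, mul_comm PowerSeries.X]
        abel
    · rw [he'j j hji hji1, Function.update_of_ne hji1, Function.update_of_ne hji]
      rcases lt_or_ge j i with h | h
      · rw [hlow j h.le]; exact ht.op j hj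
      · rw [htop' j (by omega)]; exact ht.op j hj
  · rcases eq_or_ne j i with rfl | hji
    · rw [he'i, hlow j le_rfl] at hS
      have h1 : S * PowerSeries.X = 0 := ht.indep (j + 1) hi _ <| by
        have h2 : (S * PowerSeries.X) • e (j + 1) = S • p - (S * (V : ℂ⟦X⟧)) • e j := by
          rw [hp, smul_add, smul_smul, smul_smul]; abel
        rw [h2]
        exact sub_mem (flagSpan_mono e (Nat.le_succ j) hS)
          (Submodule.smul_mem _ _ (mem_flagSpan e (Nat.lt_succ_self j)))
      exact (mul_eq_zero.1 h1).resolve_right PowerSeries.X_ne_zero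
    rcases eq_or_ne j (i + 1) with rfl | hji1
    · obtain ⟨R, y, hy, hRy⟩ := mem_flagSpan_succ.1 hS
      rw [he'i1, he'i] at hRy
      rw [hlow i le_rfl] at hy
      have h1 : S * (↑V⁻¹ : ℂ⟦X⟧) - R * PowerSeries.X = 0 := ht.indep (i + 1) hi _ <| by
        have h2 : (S * (↑V⁻¹ : ℂ⟦X⟧) - R * PowerSeries.X) • e (i + 1) =
            (R * (V : ℂ⟦X⟧)) • e i + y := by
          rw [sub_smul, mul_smul, ← hq, hRy, hp, smul_add, smul_smul, smul_smul]; abel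
        rw [h2]
        exact add_mem (Submodule.smul_mem _ _ (mem_flagSpan e (Nat.lt_succ_self i)))
          (flagSpan_mono e (Nat.le_succ i) hy)
      have h3 : R * (V : ℂ⟦X⟧) = 0 := ht.indep i (by omega) _ <| by
        have h4 : (R * (V : ℂ⟦X⟧)) • e i = -y +
            (S * (↑V⁻¹ : ℂ⟦X⟧) - R * PowerSeries.X) • e (i + 1) := by
          rw [sub_smul, mul_smul S, ← hq, hRy, hp, smul_add, smul_smul, smul_smul]; abel
        rw [h4, h1, zero_smul, add_zero]
        exact neg_mem hy
      have hR : R = 0 := (mul_eq_zero.1 h3).resolve_right V.ne_zero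
      rw [hR, zero_mul, sub_zero] at h1
      exact (mul_eq_zero.1 h1).resolve_right V⁻¹.ne_zero
    · rw [he'j j hji hji1] at hS
      rcases lt_or_ge j i with h | h
      · rw [hlow j h.le] at hS; exact ht.indep j hj S hS
      · rw [htop' j (by omega)] at hS; exact ht.indep j hj S hS

end Swap

/-! ### The minimal polynomial of a bidiagonal endomorphism -/

section Minpoly

open Polynomial in
/-- An endomorphism which is bidiagonal with nonzero off-diagonal entries in some basis is cyclic,
so its minimal polynomial is its characteristic polynomial. -/
theorem minpoly_of_bidiagonal {K V : Type*} [Field K] [AddCommGroup V] [Module K V]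
    (T : Module.End K V) {n : ℕ} {v : ℕ → V} {c w : ℕ → K}
    (hli : LinearIndependent K fun j : Fin n => v j)
    (hspan : ⊤ ≤ Submodule.span K (Set.range fun j : Fin n => v j))
    (h0 : 0 < n → T (v 0) = c 0 • v 0)
    (hs : ∀ j, j + 1 < n → T (v (j + 1)) = c (j + 1) • v (j + 1) + w j • v j)
    (hw : ∀ j, j + 1 < n → w j ≠ 0) :
    minpoly K T = ∏ j : Fin n, (X - C (c j)) := by
  let B := Module.Basis.mk hli hspan
  have hBv : ∀ j : Fin n, B j = v j := fun j => by simp [B]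
  let p : ℕ → K[X] := fun j => ∏ i ∈ Finset.range j, (X - C (c i))
  have hp : ∀ j, p (j + 1) = p j * (X - C (c j)) := fun j => Finset.prod_range_succ _ _
  have hpm : ∀ j, (p j).Monic := fun j => monic_prod_of_monic _ _ fun i _ => monic_X_sub_C _
  have hsub : ∀ i (x : V), aeval T (X - C (c i)) x = T x - c i • x := fun i x => by simp
  have hkill : ∀ j ≤ n, ∀ i < j, aeval T (p j) (v i) = 0 := by
    intro j
    induction j with
    | zero => intro _ i hi; omega
    | succ j ih =>
      intro hj i hi
      rcases Nat.lt_succ_iff_lt_or_eq.1 hi with hi | rfl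
      · rw [hp, mul_comm, map_mul, Module.End.mul_apply, ih (by omega) i hi, map_zero]
      · rw [hp, map_mul, Module.End.mul_apply, hsub]
        cases i with
        | zero => rw [h0 (by omega), sub_self, map_zero]
        | succ i =>
          rw [hs i (by omega), add_sub_cancel_left, map_smul, ih (by omega) i (by omega),
            smul_zero]
  have hzero : aeval T (p n) = 0 := B.ext fun j => by
    rw [hBv, hkill n le_rfl j j.2, LinearMap.zero_apply]
  have hint : IsIntegral K T := ⟨p n, hpm n, hzero⟩
  -- The last basis vector is a cyclic vector.
  have hcyc : ∀ d < n, ∃ q : K[X], aeval T q (v (n - 1)) = v (n - 1 - d) := by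
    intro d
    induction d with
    | zero => intro _; exact ⟨1, by simp⟩
    | succ d ih =>
      intro hd
      obtain ⟨q, hq⟩ := ih (by omega)
      obtain ⟨j, hj⟩ : ∃ j, n - 1 - d = j + 1 := ⟨n - 1 - (d + 1), by omega⟩
      refine ⟨C (w j)⁻¹ * (X - C (c (j + 1))) * q, ?_⟩
      rw [map_mul, map_mul, Module.End.mul_apply, Module.End.mul_apply, hq, hj, hsub,
        hs j (by omega), add_sub_cancel_left, aeval_C, Module.algebraMap_end_apply, smul_smul,
        inv_mul_cancel₀ (hw j (by omega)), one_smul]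
      congr 1
      omega
  have hrank : n ≤ (minpoly K T).natDegree := by
    let f : degreeLT K (minpoly K T).natDegree →ₗ[K] V :=
      ((LinearMap.applyₗ (v (n - 1))).comp (aeval T).toLinearMap).comp
        (degreeLT K (minpoly K T).natDegree).subtype
    have hf : ∀ q : K[X], aeval T q (v (n - 1)) ∈ LinearMap.range f := by
      intro q
      refine ⟨⟨q %ₘ minpoly K T, ?_⟩, ?_⟩
      · rw [mem_degreeLT, ← degree_eq_natDegree (minpoly.ne_zero hint)]
        exact degree_modByMonic_lt _ (minpoly.monic hint)
      · change aeval T (q %ₘ minpoly K T) (v (n - 1)) = _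
        rw [modByMonic_eq_sub_mul_div _ (minpoly K T), map_sub, map_mul, minpoly.aeval, zero_mul,
          sub_zero]
    have hsurj : Function.Surjective f := by
      rw [← LinearMap.range_eq_top, eq_top_iff]
      refine hspan.trans (Submodule.span_le.2 ?_)
      rintro _ ⟨j, rfl⟩
      obtain ⟨q, hq⟩ := hcyc (n - 1 - j) (by omega)
      have := hf q
      rwa [hq, show n - 1 - (n - 1 - (j : ℕ)) = j by omega] at this
    have hfin : Module.Finite K (degreeLT K (minpoly K T).natDegree) :=
      Module.Finite.equiv (degreeLTEquiv K (minpoly K T).natDegree).symm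
    have h1 := LinearMap.finrank_le_finrank_of_surjective hsurj
    rwa [Module.finrank_eq_card_basis B, Fintype.card_fin,
      (degreeLTEquiv K (minpoly K T).natDegree).finrank_eq, Module.finrank_fin_fun] at h1
  rw [← Finset.prod_range fun j => X - C (c j)]
  refine (eq_of_monic_of_dvd_of_natDegree_le (minpoly.monic hint) (hpm n)
    (minpoly.dvd K T hzero) ?_).symm
  rw [natDegree_prod_of_monic _ _ fun i _ => monic_X_sub_C _]
  simpa using hrank

end Minpoly

/-! ### The saturation and the Bernstein polynomial -/

section Bernstein

variable {E : Type u} [AddCommGroup E] [Module ℂ⟦X⟧ E]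

/-- The canonical map from `E` to `E[b⁻¹]`. -/
noncomputable abbrev toBLoc (E : Type u) [AddCommGroup E] [Module ℂ⟦X⟧ E] : E →ₗ[ℂ⟦X⟧] BLoc E :=
  LocalizedModule.mkLinearMap (Submonoid.powers (PowerSeries.X : ℂ⟦X⟧)) E

/-- The vector `b^{-m} x` of `E[b⁻¹]`. -/
noncomputable def divX (m : ℕ) (x : E) : BLoc E :=
  LocalizedModule.mk x (⟨PowerSeries.X ^ m, m, rfl⟩ : Submonoid.powers (PowerSeries.X : ℂ⟦X⟧))

theorem X_pow_smul_divX (m : ℕ) (x : E) :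
    (PowerSeries.X ^ m : ℂ⟦X⟧) • divX m x = toBLoc E x := by
  rw [divX, LocalizedModule.smul'_mk, LocalizedModule.mkLinearMap_apply, LocalizedModule.mk_eq]
  refine ⟨1, ?_⟩
  simp only [Submonoid.smul_def, one_smul]

theorem X_pow_smul_bLoc_injective (m : ℕ) :
    Function.Injective fun z : BLoc E => (PowerSeries.X ^ m : ℂ⟦X⟧) • z :=
  IsLocalizedModule.smul_injective (toBLoc E)
    (⟨PowerSeries.X ^ m, m, rfl⟩ : Submonoid.powers (PowerSeries.X : ℂ⟦X⟧))

theorem divX_zero (x : E) : divX 0 x = toBLoc E x := by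
  rw [← X_pow_smul_divX 0 x, pow_zero, one_smul]

theorem toBLoc_injective [Module.IsTorsionFree ℂ⟦X⟧ E] : Function.Injective (toBLoc E) := by
  intro x y h
  rw [LocalizedModule.mkLinearMap_apply, LocalizedModule.mkLinearMap_apply,
    LocalizedModule.mk_eq] at h
  obtain ⟨⟨_, m, rfl⟩, hw⟩ := h
  simp only [Submonoid.smul_def, one_smul] at hw
  exact smul_right_injective E (pow_ne_zero m PowerSeries.X_ne_zero) hw

theorem divX_smul (m : ℕ) (S : ℂ⟦X⟧) (x : E) : divX m (S • x) = S • divX m x :=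
  (LocalizedModule.smul'_mk _ _ _).symm

theorem divX_eq_zero (m : ℕ) : divX m (0 : E) = 0 := LocalizedModule.zero_mk _

variable [ABStructure E]

theorem aOp_toBLoc (x : E) : aOp (BLoc E) (toBLoc E x) = toBLoc E (aOp E x) := by
  rw [LocalizedModule.mkLinearMap_apply, LocalizedModule.mkLinearMap_apply]
  refine (locAFun_mk E x 1).trans ?_
  rw [mul_one, locANum, Submonoid.coe_one, one_smul, Derivation.map_one_eq_zero, mul_zero,
    zero_smul, sub_zero]

/-- The action of `b⁻¹ a` on `b^{-m} x` when `a x = λ b x + y`. -/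
theorem bInvA_divX (m : ℕ) (lam : ℂ) (x : E) :
    bInvA E (divX m x) = (PowerSeries.C (lam - m) : ℂ⟦X⟧) • divX m x
      + divX (m + 1) (aSub E lam x) := by
  refine X_pow_smul_bLoc_injective (m + 1) ?_
  change (PowerSeries.X ^ (m + 1) : ℂ⟦X⟧) • _ = (PowerSeries.X ^ (m + 1) : ℂ⟦X⟧) • _
  have h1 := aOp_X_pow_smul m (divX m x)
  rw [X_pow_smul_divX, aOp_toBLoc, smul_add, ← X_smul_bInvA, smul_smul, ← pow_succ,
    smul_comm _ ((m : ℂ⟦X⟧) * PowerSeries.X), X_pow_smul_divX, aOp_eq lam, map_add, map_smul] at h1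
  rw [smul_add, X_pow_smul_divX, smul_comm _ (PowerSeries.C (lam - m)), pow_succ',
    mul_smul _ _ (divX m x), X_pow_smul_divX, ← pow_succ', eq_sub_of_add_eq h1.symm, map_sub, map_natCast, smul_smul,
    sub_mul, sub_smul]
  abel

variable {n : ℕ} {e : ℕ → E} {lam : ℕ → ℂ} {U : ℕ → ℂ⟦X⟧ˣ}

/-- The vector `b^{-(n - 1 - j)} e_j`.  For a normal form `e` of length `n`, these vectors with
`j < n` form a basis of the saturation of `E`. -/
noncomputable def satVec (n : ℕ) (e : ℕ → E) (j : ℕ) : BLoc E := divX (n - 1 - j) (e j)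

theorem IsABChain.bInvA_satVec_zero (h : IsABChain n e lam U) (hn : 0 < n) :
    bInvA E (satVec n e 0) = (PowerSeries.C (lam 0 - (n - 1 - 0 : ℕ)) : ℂ⟦X⟧) • satVec n e 0 := by
  rw [satVec, bInvA_divX _ (lam 0), h.op_zero hn, divX_eq_zero, add_zero]

theorem IsABChain.bInvA_satVec_succ (h : IsABChain n e lam U) {j : ℕ} (hj : j + 1 < n) :
    bInvA E (satVec n e (j + 1)) =
      (PowerSeries.C (lam (j + 1) - (n - 1 - (j + 1) : ℕ)) : ℂ⟦X⟧) • satVec n e (j + 1)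
        + (U j : ℂ⟦X⟧) • satVec n e j := by
  rw [satVec, bInvA_divX _ (lam (j + 1)), h.op_succ j hj, divX_smul, satVec,
    show n - 1 - (j + 1) + 1 = n - 1 - j by omega]

/-- The span of the vectors `b^{-(n - 1 - j)} e_j` is stable by `b⁻¹ a`; conversely, applying
`b⁻¹ a` to `e_{n-1}` repeatedly yields all of them, since the `U_j` are invertible. -/
theorem IsABChain.saturation_eq (h : IsABChain n e lam U) (htop : flagSpan e n = ⊤) :
    saturation E = flagSpan (satVec n e) n := by
  refine le_antisymm (sInf_le ⟨?_, fun z hz => ?_⟩) ?_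
  · rintro _ ⟨x, rfl⟩
    have hx : x ∈ flagSpan e n := htop ▸ Submodule.mem_top
    obtain ⟨T, rfl⟩ := exists_sum_of_mem_flagSpan hx
    rw [map_sum]
    refine sum_mem fun i hi => ?_
    rw [map_smul, ← X_pow_smul_divX (n - 1 - i)]
    exact Submodule.smul_mem _ _ (Submodule.smul_mem _ _
      (mem_flagSpan (satVec n e) (Finset.mem_range.1 hi)))
  · obtain ⟨T, rfl⟩ := exists_sum_of_mem_flagSpan hz
    rw [map_sum]
    refine sum_mem fun i hi => ?_
    have hi := Finset.mem_range.1 hi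
    rw [bInvA_smul]
    refine add_mem (Submodule.smul_mem _ _ ?_) (Submodule.smul_mem _ _ (mem_flagSpan _ hi))
    cases i with
    | zero => rw [h.bInvA_satVec_zero hi]; exact Submodule.smul_mem _ _ (mem_flagSpan _ hi)
    | succ i =>
      rw [h.bInvA_satVec_succ hi]
      exact add_mem (Submodule.smul_mem _ _ (mem_flagSpan _ hi))
        (Submodule.smul_mem _ _ (mem_flagSpan _ (by omega)))
  · refine Submodule.span_le.2 ?_
    rintro _ ⟨j, hj, rfl⟩
    refine Submodule.mem_sInf.2 fun G hG => ?_
    have key : ∀ d < n, satVec n e (n - 1 - d) ∈ G := by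
      intro d
      induction d with
      | zero =>
        intro _
        rw [satVec, Nat.sub_zero, Nat.sub_self, divX_zero]
        exact hG.1 ⟨_, rfl⟩
      | succ d ih =>
        intro hd
        have hm := ih (by omega)
        rw [show n - 1 - d = n - 1 - (d + 1) + 1 by omega] at hm
        have h1 := h.bInvA_satVec_succ (j := n - 1 - (d + 1)) (by omega)
        have h2 := sub_mem (hG.2 _ hm) (G.smul_mem (PowerSeries.C (lam (n - 1 - (d + 1) + 1)
          - (n - 1 - (n - 1 - (d + 1) + 1) : ℕ))) hm)
        rw [h1, add_sub_cancel_left] at h2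
        have h3 := G.smul_mem (↑(U (n - 1 - (d + 1)))⁻¹ : ℂ⟦X⟧) h2
        rwa [smul_smul, Units.inv_mul, one_smul] at h3
    have hj : j < n := hj
    have := key (n - 1 - j) (by omega)
    rwa [show n - 1 - (n - 1 - j) = j by omega] at this

theorem IsABChain.satVec_linearIndependent [Module.IsTorsionFree ℂ⟦X⟧ E]
    (h : IsABChain n e lam U) : LinearIndependent ℂ⟦X⟧ fun j : Fin n => satVec n e j := by
  rw [Fintype.linearIndependent_iff]
  intro g hg i
  have h1 := congrArg (fun z => (PowerSeries.X ^ (n - 1) : ℂ⟦X⟧) • z) hg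
  have h2 : ∀ j : Fin n, (PowerSeries.X ^ (n - 1) : ℂ⟦X⟧) • g j • satVec n e j =
      toBLoc E ((g j * PowerSeries.X ^ (j : ℕ)) • e j) := fun j => by
    rw [map_smul, ← X_pow_smul_divX (n - 1 - j), smul_smul, smul_smul, mul_assoc, ← pow_add,
      Nat.add_sub_cancel' (by omega), mul_comm, satVec]
  simp only [smul_zero, Finset.smul_sum, h2] at h1
  rw [← map_sum, ← map_zero (toBLoc E)] at h1
  have h3 := Fintype.linearIndependent_iff.1 (linearIndependent_of_flag h.indep) _
    (toBLoc_injective h1) i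
  exact (mul_eq_zero.1 h3).resolve_right (pow_ne_zero _ PowerSeries.X_ne_zero)

theorem eq_C_add_X_mul (S : ℂ⟦X⟧) :
    ∃ R : ℂ⟦X⟧, S = PowerSeries.C (PowerSeries.constantCoeff S) + PowerSeries.X * R := by
  have : PowerSeries.X ∣ S - PowerSeries.C (PowerSeries.constantCoeff S) := by
    rw [PowerSeries.X_dvd_iff, map_sub, PowerSeries.constantCoeff_C, sub_self]
  obtain ⟨R, hR⟩ := this
  exact ⟨R, by rw [← hR]; ring⟩

/-- The class in the fibre of the saturation. -/
noncomputable def satMk : saturation E →ₗ[ℂ⟦X⟧] SatFibre E :=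
  (bTimes ⊤ : Submodule ℂ⟦X⟧ (saturation E)).mkQ

theorem satMk_surjective : Function.Surjective (satMk (E := E)) :=
  Submodule.mkQ_surjective _

theorem satMk_eq_zero {z : saturation E} :
    satMk z = 0 ↔ ∃ y : saturation E, (PowerSeries.X : ℂ⟦X⟧) • y = z := by
  refine (Submodule.Quotient.mk_eq_zero (bTimes ⊤ : Submodule ℂ⟦X⟧ (saturation E))).trans ?_
  exact ⟨fun ⟨y, _, hy⟩ => ⟨y, hy⟩, fun ⟨y, hy⟩ => ⟨y, trivial, hy⟩⟩

theorem satMk_C_smul (c : ℂ) (z : saturation E) :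
    satMk ((PowerSeries.C c : ℂ⟦X⟧) • z) = c • satMk z := rfl

theorem satMk_smul (S : ℂ⟦X⟧) (z : saturation E) :
    satMk (S • z) = PowerSeries.constantCoeff S • satMk z := by
  obtain ⟨R, hR⟩ := eq_C_add_X_mul S
  rw [← satMk_C_smul, ← sub_eq_zero, ← map_sub, satMk_eq_zero]
  refine ⟨R • z, ?_⟩
  rw [smul_smul, ← sub_eq_of_eq_add' hR]
  exact sub_smul _ _ _

theorem satFibreOp_satMk (z : saturation E) : satFibreOp E (satMk z) = satMk (satOp E z) := rfl

/-- In a normal form, the Bernstein polynomial has the roots `-(λ_j + j + 1 - n)`: on the basis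
given by the vectors `b^{-(n - 1 - j)} e_j`, the operator `b⁻¹ a` is bidiagonal. -/
theorem IsABChain.bernsteinPoly_eq [Module.IsTorsionFree ℂ⟦X⟧ E] (h : IsABChain n e lam U)
    (htop : flagSpan e n = ⊤) :
    bernsteinPoly E = ∏ j : Fin n, (Polynomial.X +
      Polynomial.C (lam j + ((j : ℕ) + 1) - n)) := by
  have hsat := h.saturation_eq htop
  have hmem : ∀ j < n, satVec n e j ∈ saturation E := fun j hj => hsat ▸ mem_flagSpan _ hj
  classical
  let f : ℕ → saturation E := fun j => if hj : j < n then ⟨satVec n e j, hmem j hj⟩ else 0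
  have hf : ∀ j < n, (f j : BLoc E) = satVec n e j := fun j hj => by simp [f, hj]
  have hrep : ∀ z : saturation E, ∃ T : ℕ → ℂ⟦X⟧, z = ∑ j : Fin n, T j • f j := by
    rintro ⟨z, hz⟩
    have hz' := hz
    rw [hsat] at hz'
    obtain ⟨T, hT⟩ := exists_sum_of_mem_flagSpan hz'
    refine ⟨T, Subtype.ext ?_⟩
    rw [← Finset.sum_range fun j => T j • f j, AddSubmonoidClass.coe_finsetSum]
    change z = _
    rw [hT]
    exact Finset.sum_congr rfl fun j hj => by
      rw [Submodule.coe_smul, hf j (Finset.mem_range.1 hj)]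
  have hli := h.satVec_linearIndependent
  have hmin := minpoly_of_bidiagonal (-satFibreOp E) (n := n) (v := fun j => satMk (f j))
    (c := fun j => -(lam j - (n - 1 - j : ℕ)))
    (w := fun j => -PowerSeries.constantCoeff (U j : ℂ⟦X⟧)) ?_ ?_ ?_ ?_ ?_
  · rw [bernsteinPoly, hmin]
    refine Finset.prod_congr rfl fun j _ => ?_
    have hj : (((n - 1 - (j : ℕ) : ℕ)) : ℂ) = n - 1 - (j : ℕ) := by
      rw [Nat.cast_sub (by have := j.2; omega), Nat.cast_sub (by have := j.2; omega), Nat.cast_one]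
    rw [Polynomial.C_neg, sub_neg_eq_add, hj]
    congr 2
    ring
  · rw [Fintype.linearIndependent_iff]
    intro g hg i
    have h1 : satMk (∑ j : Fin n, (PowerSeries.C (g j) : ℂ⟦X⟧) • f j) = 0 := by
      rw [map_sum]; exact hg
    obtain ⟨y, hy⟩ := satMk_eq_zero.1 h1
    obtain ⟨T, rfl⟩ := hrep y
    have h2 := congrArg Subtype.val hy
    rw [Submodule.coe_smul, AddSubmonoidClass.coe_finsetSum, AddSubmonoidClass.coe_finsetSum,
      Finset.smul_sum, ← sub_eq_zero, ← Finset.sum_sub_distrib] at h2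
    have h3 := Fintype.linearIndependent_iff.1 hli
      (fun j => PowerSeries.X * T j - PowerSeries.C (g j)) (by
        rw [← h2]
        refine Finset.sum_congr rfl fun j _ => ?_
        rw [Submodule.coe_smul, Submodule.coe_smul, hf j j.2, sub_smul, mul_smul]) i
    have h4 := congrArg PowerSeries.constantCoeff h3
    simpa using h4
  · rintro z -
    obtain ⟨z, rfl⟩ := satMk_surjective z
    obtain ⟨T, rfl⟩ := hrep z
    rw [map_sum]
    refine sum_mem fun j _ => ?_
    rw [satMk_smul]
    exact Submodule.smul_mem _ _ (Submodule.subset_span ⟨j, rfl⟩)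
  · intro hn
    have h1 : satOp E (f 0) = (PowerSeries.C (lam 0 - (n - 1 - 0 : ℕ)) : ℂ⟦X⟧) • f 0 := by
      refine Subtype.ext ?_
      change bInvA E (f 0 : BLoc E) = _
      rw [Submodule.coe_smul, hf 0 hn, h.bInvA_satVec_zero hn]
    rw [LinearMap.neg_apply, satFibreOp_satMk, h1, satMk_C_smul, neg_smul]
  · intro j hj
    have h1 : satOp E (f (j + 1)) =
        (PowerSeries.C (lam (j + 1) - (n - 1 - (j + 1) : ℕ)) : ℂ⟦X⟧) • f (j + 1)
          + (U j : ℂ⟦X⟧) • f j := by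
      refine Subtype.ext ?_
      change bInvA E (f (j + 1) : BLoc E) = _
      rw [Submodule.coe_add, Submodule.coe_smul, Submodule.coe_smul, hf _ hj, hf j (by omega),
        h.bInvA_satVec_succ hj]
    rw [LinearMap.neg_apply, satFibreOp_satMk, h1, map_add, satMk_C_smul, satMk_smul, neg_smul,
      neg_smul, neg_add]
  · intro j _
    exact neg_ne_zero.2 (PowerSeries.isUnit_iff_constantCoeff.1 (U j).isUnit).ne_zero

end Bernstein

/-! ### The order on the rational numbers and sorting -/

section Order

/-- A property of tuples which is preserved by exchanging adjacent entries in the wrong order, and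
holds for some tuple, holds for a sorted one: take a lexicographically minimal rearrangement. -/
theorem exists_sorted_of_adjacent_swap {α β : Type*} [LinearOrder α] (key : β → α) {n : ℕ}
    {P : (Fin n → β) → Prop} {f : Fin n → β} (hf : P f)
    (h : ∀ g, P g → ∀ i j : Fin n, (j : ℕ) = i + 1 → key (g j) < key (g i) →
      P (g ∘ Equiv.swap i j)) :
    ∃ g, P g ∧ Monotone (key ∘ g) := by
  obtain ⟨σ, hσ, hmin⟩ := Set.exists_min_image {σ : Equiv.Perm (Fin n) | P (f ∘ σ)}
    (fun σ => toLex (key ∘ f ∘ σ)) (Set.toFinite _) ⟨1, hf⟩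
  refine ⟨f ∘ σ, hσ, ?_⟩
  cases n with
  | zero => exact fun i => i.elim0
  | succ n =>
    refine Fin.monotone_iff_le_succ.2 fun i => ?_
    by_contra hlt
    rw [not_le] at hlt
    exact not_lt_of_ge (hmin (σ * Equiv.swap i.castSucc i.succ)
      (h (f ∘ σ) hσ i.castSucc i.succ (by simp) hlt))
      (Pi.lex_desc (f := key ∘ f ∘ σ) Fin.castSucc_lt_succ.le hlt)

variable (ord : LinearOrder (AddCircle (1 : ℚ)))

/-- An embedding of `ℚ` in a lexicographic product, from which the order `ratLE` is induced. -/
def ratKey (q : ℚ) : Lex (AddCircle (1 : ℚ) × ℚ) := toLex ((q : AddCircle (1 : ℚ)), q)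

theorem ratLE_iff_key (p q : ℚ) : ratLE ord p q ↔ ratKey p ≤ ratKey q :=
  (Prod.Lex.le_iff (x := ratKey p) (y := ratKey q)).symm

theorem coe_eq_coe_of_add_natCast {p q : ℚ} {n : ℕ} (h : p = q + n) :
    (p : AddCircle (1 : ℚ)) = (q : AddCircle (1 : ℚ)) := by
  have hn : ((n : ℚ) : AddCircle (1 : ℚ)) = 0 :=
    (AddCircle.coe_eq_zero_iff (1 : ℚ)).2 ⟨n, by simp⟩
  rw [h, AddCircle.coe_add, hn, add_zero]

theorem ratLE_antisymm {p q : ℚ} (h1 : ratLE ord p q) (h2 : ratLE ord q p) : p = q := by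
  rw [ratLE_iff_key] at h1 h2
  exact congrArg (fun z => (ofLex z).2) (le_antisymm h1 h2)

/-- Inside a class modulo `ℤ`, the order is the usual one. -/
theorem le_of_ratLE {p q : ℚ} (h : ratLE ord p q)
    (hc : (p : AddCircle (1 : ℚ)) = (q : AddCircle (1 : ℚ))) : p ≤ q := by
  rcases h with h | h
  · exact absurd hc (ne_of_lt h)
  · exact h.2

theorem ratLE_sub_natCast {p q : ℚ} (n : ℕ) (h : ratLE ord p q) :
    ratLE ord (p - n) (q - n) := by
  have hc : ∀ x : ℚ, ((x - n : ℚ) : AddCircle (1 : ℚ)) = (x : AddCircle (1 : ℚ)) := fun x =>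
    (coe_eq_coe_of_add_natCast (by ring : x = (x - n) + n)).symm
  rw [ratLE, hc, hc]
  exact h.imp id fun h => ⟨h.1, sub_le_sub_right h.2 _⟩

open Polynomial in
/-- Two increasing sequences which are, up to order, the opposites of the roots of the same
polynomial are equal. -/
theorem eq_of_prod_eq_of_ratLE {n : ℕ} {f g : Fin n → ℚ}
    (hf : ∀ i j, i ≤ j → ratLE ord (f i) (f j)) (hg : ∀ i j, i ≤ j → ratLE ord (g i) (g j))
    (h : ∏ j, (X + C ((f j : ℚ) : ℂ)) = ∏ j, (X + C ((g j : ℚ) : ℂ))) : f = g := by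
  have hroots : ∀ f : Fin n → ℚ, (∏ j, (X + C ((f j : ℚ) : ℂ))).roots =
      Multiset.map (fun q : ℚ => -(q : ℂ)) (List.ofFn f) := fun f => by
    rw [← Fin.univ_val_map, Multiset.map_map]
    have : ∏ j, (X + C ((f j : ℚ) : ℂ)) =
        (Multiset.map (fun z => X - C z) (Multiset.map ((fun q : ℚ => -(q : ℂ)) ∘ f)
          Finset.univ.val)).prod := by
      rw [Multiset.map_map]
      change _ = ∏ j, _
      exact Finset.prod_congr rfl fun j _ => by simp
    rw [this, roots_multiset_prod_X_sub_C]
  have hperm : (List.ofFn f).Perm (List.ofFn g) := by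
    have h1 := congrArg roots h
    rw [hroots, hroots] at h1
    refine Multiset.coe_eq_coe.1 (Multiset.map_injective ?_ h1)
    exact fun p q hpq => by simpa using hpq
  exact List.ofFn_injective (hperm.eq_of_pairwise (le := ratLE ord)
    (fun a b _ _ => ratLE_antisymm ord)
    (List.pairwise_ofFn.2 fun i j hij => hf i j hij.le)
    (List.pairwise_ofFn.2 fun i j hij => hg i j hij.le))

end Order

/-! ### Sorted triangular bases of frescos -/

section Fresco

variable {E : Type u} [AddCommGroup E] [Module ℂ⟦X⟧ E] [ABStructure E]

theorem IsFresco.isTorsionFree (hE : IsFresco E) : Module.IsTorsionFree ℂ⟦X⟧ E :=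
  have := hE.abModule.free
  inferInstance

/-- A triangular basis of a fresco can be put in normal form, with the same flag. -/
theorem IsFresco.exists_chain (hE : IsFresco E) {n : ℕ} {e : ℕ → E} {lam : ℕ → ℂ}
    (ht : IsTriangular n e lam) (htop : flagSpan e n = ⊤) :
    ∃ (e' : ℕ → E) (U : ℕ → ℂ⟦X⟧ˣ), IsABChain n e' lam U ∧
      ∀ j ≤ n, flagSpan e' j = flagSpan e j := by
  obtain ⟨g, hg⟩ := hE.monogenic
  obtain ⟨e', U, hc, he⟩ := ht.exists_chain (g := g)
    ⟨htop ▸ Submodule.mem_top, fun H hH => (hg H hH).ge.trans' le_top⟩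
  exact ⟨e', U, hc, fun j hj => flagSpan_congr fun i hi => he i (by omega)⟩

theorem IsFresco.bernsteinPoly_eq (hE : IsFresco E) {n : ℕ} {e : ℕ → E} {lam : ℕ → ℂ}
    (ht : IsTriangular n e lam) (htop : flagSpan e n = ⊤) :
    bernsteinPoly E = ∏ j : Fin n, (Polynomial.X +
      Polynomial.C (lam j + ((j : ℕ) + 1) - n)) := by
  have := hE.isTorsionFree
  obtain ⟨e', U, hc, he⟩ := hE.exists_chain ht htop
  exact hc.bernsteinPoly_eq ((he n le_rfl).trans htop)

/-- The numbers `λ_j + j + 1 - n` attached to a triangular basis of a fresco are the opposites of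
roots of its Bernstein polynomial, hence positive and rational. -/
theorem IsFresco.exists_rat (hE : IsFresco E) {n : ℕ} {e : ℕ → E} {lam : ℕ → ℂ}
    (ht : IsTriangular n e lam) (htop : flagSpan e n = ⊤) (j : Fin n) :
    ∃ q : ℚ, 0 < q ∧ lam j + ((j : ℕ) + 1) - n = (q : ℂ) := by
  obtain ⟨q, hq, h⟩ := hE.geometric.2 (-(lam j + ((j : ℕ) + 1) - n)) <| by
    rw [hE.bernsteinPoly_eq ht htop, Polynomial.IsRoot, Polynomial.eval_prod]
    exact Finset.prod_eq_zero (Finset.mem_univ j) (by simp)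
  exact ⟨-q, by linarith, by rw [← neg_neg (_ - _), h]; push_cast; ring⟩

/-- A fresco has a triangular basis with rational `λ_j` such that `λ_j + j` is increasing: starting
from any triangular basis, exchange consecutive rank one quotients in the wrong order. -/
theorem IsFresco.exists_sorted_triangular (hE : IsFresco E)
    (ord : LinearOrder (AddCircle (1 : ℚ))) {k : ℕ} (hk : Module.finrank ℂ⟦X⟧ E = k) :
    ∃ (e : ℕ → E) (lam : ℕ → ℂ) (mu : Fin k → ℚ), IsTriangular k e lam ∧ flagSpan e k = ⊤ ∧
      (∀ j : Fin k, lam j = ((mu j - ((j : ℕ) + 1) : ℚ) : ℂ)) ∧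
      ∀ i j, i ≤ j → ratLE ord (mu i) (mu j) := by
  have := hE.abModule.free
  have := hE.abModule.finite
  let P : (Fin k → ℚ) → Prop := fun mu => ∃ (e : ℕ → E) (lam : ℕ → ℂ), IsTriangular k e lam ∧
    flagSpan e k = ⊤ ∧ ∀ j : Fin k, lam j = ((mu j - ((j : ℕ) + 1) : ℚ) : ℂ)
  obtain ⟨mu, hmu⟩ : ∃ mu, P mu := by
    obtain ⟨e, lam, ht, htop⟩ := exists_triangular hE.geometric.1.hasSimplePoleLattice
    rw [hk] at ht htop
    choose q _ hq using hE.exists_rat ht htop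
    refine ⟨fun j => q j + k, e, lam, ht, htop, fun j => ?_⟩
    push_cast
    rw [← hq]
    ring
  obtain ⟨mu, ⟨e, lam, h1, h2, h3⟩, hmono⟩ := exists_sorted_of_adjacent_swap ratKey hmu <| by
    rintro mu ⟨e, lam, ht, htop, hlam⟩ i j hij hlt
    obtain ⟨e', U, hc, he⟩ := hE.exists_chain ht htop
    have hi := i.2
    have hj := j.2
    have hli := hlam i
    have hlj := hlam j
    rw [hij] at hlj
    obtain ⟨e'', ht', htop'⟩ := hc.isTriangular.exists_swap (i := i) (by omega) (U := U i)
      (by rw [hc.op_succ i (by omega), sub_self]; exact zero_mem _) (by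
        intro m hm
        rw [hli, hlj] at hm
        have hm' : mu j = mu i + m := by
          have : ((mu j : ℚ) : ℂ) = ((mu i + m : ℚ) : ℂ) := by
            push_cast at hm ⊢
            linear_combination -hm
          exact_mod_cast this
        refine not_le_of_gt hlt ((ratLE_iff_key ord _ _).1
          (Or.inr ⟨(coe_eq_coe_of_add_natCast hm').symm, ?_⟩))
        rw [hm']
        exact le_add_of_nonneg_right m.cast_nonneg)
    refine ⟨e'', _, ht', htop'.trans ((he k le_rfl).trans htop), fun l => ?_⟩
    rw [Function.comp_apply]
    rcases eq_or_ne l i with rfl | hli'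
    · rw [Equiv.swap_apply_left, Function.update_of_ne (by omega), Function.update_self, hlj]
      push_cast
      ring
    rcases eq_or_ne l j with rfl | hlj'
    · rw [Equiv.swap_apply_right, hij, Function.update_self, hli]
      push_cast
      ring
    · rw [Equiv.swap_apply_of_ne_of_ne hli' hlj', Function.update_of_ne, Function.update_of_ne,
        hlam]
      · exact fun h => hli' (Fin.ext h)
      · exact fun h => hlj' (Fin.ext (h.trans hij.symm))
  exact ⟨e, lam, mu, h1, h2, h3, fun i j hij => (ratLE_iff_key ord _ _).2 (hmono hij)⟩

end Fresco

/-! ### Uniqueness of the sorted flag -/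

section Uniqueness

variable {E : Type u} [AddCommGroup E] [Module ℂ⟦X⟧ E] [ABStructure E]

/-- The coordinates of `(a - μ b) x` in a normal form. -/
theorem IsABChain.aSub_sum {n : ℕ} {e : ℕ → E} {lam : ℕ → ℂ} {U : ℕ → ℂ⟦X⟧ˣ}
    (h : IsABChain n e lam U) (mu : ℂ) {T : ℕ → ℂ⟦X⟧} (hT : T n = 0) :
    aSub E mu (∑ i ∈ Finset.range n, T i • e i) =
      ∑ i ∈ Finset.range n, (rankOneA (lam i - mu) (T i) + T (i + 1) * U i) • e i := by
  have h1 : ∑ i ∈ Finset.range n, T i • aSub E (lam i) (e i) =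
      ∑ i ∈ Finset.range n, (T (i + 1) * U i) • e i := by
    cases n with
    | zero => rfl
    | succ n =>
      rw [Finset.sum_range_succ', h.op_zero (by omega), smul_zero, add_zero,
        Finset.sum_range_succ, hT, zero_mul, zero_smul, add_zero]
      refine Finset.sum_congr rfl fun i hi => ?_
      rw [h.op_succ i (by have := Finset.mem_range.1 hi; omega), smul_smul]
  simp only [add_smul]
  rw [map_sum, Finset.sum_add_distrib, ← h1, ← Finset.sum_add_distrib]
  exact Finset.sum_congr rfl fun i _ => by rw [aSub_smul (lam i), add_comm]

/-- Let `x = ∑ T_i e_i` be an eigenvector for `λ_j` modulo `F_j`, in a normal form.  The equations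
`b² T_i' + (λ_i - λ_j) b T_i + U_i T_{i+1} = 0` for `i ≥ j` show that `b^{i-j+1}` divides `T_i` for
`i > j`.  The last nonzero coefficient is a monomial `b^N` with `λ_j = λ_m + N`, and `N ≥ m - j + 1`
contradicts the order of the `λ_i + i` unless `m ≤ j`. -/
theorem IsABChain.mem_flagSpan_of_eigenvector {n : ℕ} {e : ℕ → E} {lam : ℕ → ℂ} {U : ℕ → ℂ⟦X⟧ˣ}
    (h : IsABChain n e lam U) (htop : flagSpan e n = ⊤)
    (hsort : ∀ i m, i < m → m < n → ∀ N : ℕ, lam i = lam m + N → N + i ≤ m) {j : ℕ} (hj : j < n)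
    {x : E} (hx : aSub E (lam j) x ∈ flagSpan e j) : x ∈ flagSpan e (j + 1) := by
  obtain ⟨T, rfl, hTn⟩ : ∃ T : ℕ → ℂ⟦X⟧, x = ∑ i ∈ Finset.range n, T i • e i ∧
      ∀ i, n ≤ i → T i = 0 := by
    obtain ⟨T, rfl⟩ := exists_sum_of_mem_flagSpan (htop ▸ Submodule.mem_top : x ∈ flagSpan e n)
    refine ⟨fun i => if i < n then T i else 0, ?_, fun i hi => if_neg (by omega)⟩
    exact Finset.sum_congr rfl fun i hi => by simp only [if_pos (Finset.mem_range.1 hi)]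
  rw [h.aSub_sum _ (hTn n le_rfl)] at hx
  have hcoef := sum_smul_mem_flagSpan h.indep _ hx
  have hstep : ∀ i, j ≤ i → i < n → ∀ d, PowerSeries.X ^ d ∣ rankOneA (lam i - lam j) (T i) →
      PowerSeries.X ^ d ∣ T (i + 1) := by
    intro i hji hi d hd
    have h1 := (dvd_add_right hd).1 ((hcoef i hji hi).symm ▸ dvd_zero (PowerSeries.X ^ d))
    exact (U i).isUnit.dvd_mul_right.1 h1
  have hdvd : ∀ d, PowerSeries.X ^ (d + 2) ∣ T (j + d + 1) := by
    intro d
    induction d with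
    | zero =>
      refine hstep j le_rfl hj _ ?_
      rw [rankOneA_apply, sub_self, map_zero, zero_mul, zero_mul, add_zero]
      exact dvd_mul_right _ _
    | succ d ih =>
      rcases lt_or_ge (j + d + 1) n with hn | hn
      · exact hstep (j + d + 1) (by omega) hn _ (X_pow_succ_dvd_rankOneA _ ih)
      · rw [hTn _ (by omega)]; exact dvd_zero _
  have hzero : ∀ d m, n ≤ m + d → j < m → T m = 0 := by
    intro d
    induction d with
    | zero => exact fun m hm _ => hTn m hm
    | succ d ih =>
      intro m hm hjm
      by_contra hne
      have hmn : m < n := by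
        by_contra hc
        exact hne (hTn m (by omega))
      have h1 := hcoef m hjm.le hmn
      rw [ih (m + 1) (by omega) (by omega), zero_mul, add_zero] at h1
      obtain ⟨N, hN, hcN⟩ := exists_coeff_ne_zero_of_rankOneA_eq_zero h1 hne
      have h2 := hsort j m hjm hmn N (by linear_combination -hN)
      have h3 := hdvd (m - j - 1)
      rw [show j + (m - j - 1) + 1 = m by omega] at h3
      exact hcN (PowerSeries.X_pow_dvd_iff.1 h3 N (by omega))
  refine sum_mem fun i _ => ?_
  rcases lt_or_ge j i with hi | hi
  · rw [hzero n i (by omega) hi, zero_smul]; exact zero_mem _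
  · exact Submodule.smul_mem _ _ (mem_flagSpan e (by omega))

/-- Two normal forms with the same `λ_j`, in increasing order, have the same flag. -/
theorem IsABChain.flagSpan_eq {n : ℕ} {e e' : ℕ → E} {lam : ℕ → ℂ} {U U' : ℕ → ℂ⟦X⟧ˣ}
    (h : IsABChain n e lam U) (htop : flagSpan e n = ⊤)
    (h' : IsABChain n e' lam U') (htop' : flagSpan e' n = ⊤)
    (hsort : ∀ i m, i < m → m < n → ∀ N : ℕ, lam i = lam m + N → N + i ≤ m) {j : ℕ}
    (hj : j ≤ n) : flagSpan e j = flagSpan e' j := by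
  induction j with
  | zero => rw [flagSpan_zero, flagSpan_zero]
  | succ j ih =>
    have ih := ih (by omega)
    refine le_antisymm ?_ ?_
    · rw [flagSpan_succ, sup_le_iff, Submodule.span_singleton_le_iff_mem, ih]
      refine ⟨h'.mem_flagSpan_of_eigenvector htop' hsort hj ?_, flagSpan_mono e' (Nat.le_succ j)⟩
      rw [← ih]
      exact h.isTriangular.op j hj
    · rw [flagSpan_succ, sup_le_iff, Submodule.span_singleton_le_iff_mem, ← ih]
      refine ⟨h.mem_flagSpan_of_eigenvector htop hsort hj ?_, flagSpan_mono e (Nat.le_succ j)⟩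
      rw [ih]
      exact h'.isTriangular.op j hj

end Uniqueness

/-! ### Sub-quotients and isomorphisms -/

section Quotients

theorem map_flagSpan {E : Type u} {E' : Type v} [AddCommGroup E] [Module ℂ⟦X⟧ E] [AddCommGroup E']
    [Module ℂ⟦X⟧ E'] (f : E ≃ₗ[ℂ⟦X⟧] E') (e : ℕ → E) (j : ℕ) :
    (flagSpan e j).map (f : E →ₗ[ℂ⟦X⟧] E') = flagSpan (fun i => f (e i)) j := by
  rw [flagSpan, Submodule.map_span, ← Set.image_comp]
  rfl

variable {E : Type u} [AddCommGroup E] [Module ℂ⟦X⟧ E] [ABStructure E]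

/-- A generator of a sub-quotient isomorphic to `E_λ`. -/
theorem ABSubmodule.exists_generator {F G : ABSubmodule E} {lam : ℂ}
    (h : ABIso (F.SubQuot G) (RankOne lam)) :
    ∃ x ∈ G.toSubmodule, aSub E lam x ∈ F.toSubmodule ∧
      (∀ S : ℂ⟦X⟧, S • x ∈ F.toSubmodule → S = 0) ∧
      ∀ y ∈ G.toSubmodule, ∃ S : ℂ⟦X⟧, y - S • x ∈ F.toSubmodule := by
  obtain ⟨f, hf⟩ := h
  obtain ⟨z, hz⟩ := f.surjective (1 : ℂ⟦X⟧)
  obtain ⟨⟨x, hx⟩, rfl⟩ := Submodule.Quotient.mk_surjective _ z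
  let q : G.toSubmodule →ₗ[ℂ⟦X⟧] F.SubQuot G := (F.within G).toSubmodule.mkQ
  have hq : ∀ w : G.toSubmodule, f (q w) = (0 : ℂ⟦X⟧) ↔ (w : E) ∈ F.toSubmodule := fun w =>
    (f.map_eq_zero_iff (x := q w)).trans (Submodule.Quotient.mk_eq_zero (F.within G).toSubmodule)
  have hfx : f (q ⟨x, hx⟩) = (1 : ℂ⟦X⟧) := hz
  have hS : ∀ S : ℂ⟦X⟧, f (q (S • ⟨x, hx⟩)) = S := fun S => by
    rw [map_smul, map_smul, hfx]
    exact mul_one S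
  refine ⟨x, hx, ?_, fun S h => ?_, fun y hy => ?_⟩
  · refine (hq (aOp G.toSubmodule ⟨x, hx⟩ -
      (PowerSeries.C lam * PowerSeries.X : ℂ⟦X⟧) • ⟨x, hx⟩)).1 ?_
    rw [map_sub, map_sub, hS]
    have h1 : f (q (aOp G.toSubmodule ⟨x, hx⟩)) = rankOneA lam (1 : ℂ⟦X⟧) :=
      (hf (q ⟨x, hx⟩)).trans (congrArg (rankOneA lam) hfx)
    rw [h1, rankOneA_apply, Derivation.map_one_eq_zero, mul_zero, zero_add, mul_one]
    exact sub_self _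
  · exact (hS S).symm.trans ((hq (S • ⟨x, hx⟩)).2 h)
  · obtain ⟨S, hyS⟩ : ∃ S : ℂ⟦X⟧, f (q ⟨y, hy⟩) = S := ⟨_, rfl⟩
    refine ⟨S, (hq (⟨y, hy⟩ - S • ⟨x, hx⟩)).1 ?_⟩
    rw [map_sub, map_sub, hS, hyS]
    exact sub_self _

/-- The isomorphism with `E_λ` sends `x` to the standard generator. -/
theorem ABSubmodule.abIso_of_generator {F G : ABSubmodule E} {lam : ℂ} {x : E}
    (hx : x ∈ G.toSubmodule) (hax : aSub E lam x ∈ F.toSubmodule)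
    (hind : ∀ S : ℂ⟦X⟧, S • x ∈ F.toSubmodule → S = 0)
    (hgen : ∀ y ∈ G.toSubmodule, ∃ S : ℂ⟦X⟧, y - S • x ∈ F.toSubmodule) :
    ABIso (F.SubQuot G) (RankOne lam) := by
  let q : G.toSubmodule →ₗ[ℂ⟦X⟧] F.SubQuot G := (F.within G).toSubmodule.mkQ
  have hq : ∀ w : G.toSubmodule, q w = 0 ↔ (w : E) ∈ F.toSubmodule := fun w =>
    Submodule.Quotient.mk_eq_zero (F.within G).toSubmodule
  let f : RankOne lam →ₗ[ℂ⟦X⟧] F.SubQuot G :=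
    LinearMap.toSpanSingleton ℂ⟦X⟧ (F.SubQuot G) (q ⟨x, hx⟩)
  have hf : ∀ S : ℂ⟦X⟧, f S = S • q ⟨x, hx⟩ := fun _ => rfl
  have hinj : Function.Injective f := by
    rw [← LinearMap.ker_eq_bot, LinearMap.ker_eq_bot']
    intro (S : ℂ⟦X⟧) hS
    exact hind S ((hq (S • ⟨x, hx⟩)).1 hS)
  have hsurj : Function.Surjective f := by
    intro z
    obtain ⟨⟨y, hy⟩, rfl⟩ := Submodule.Quotient.mk_surjective _ z
    obtain ⟨S, hS⟩ := hgen y hy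
    refine ⟨S, ?_⟩
    have := (hq (⟨y, hy⟩ - S • ⟨x, hx⟩)).2 hS
    rw [map_sub, map_smul, sub_eq_zero] at this
    exact this.symm
  have hcomm : ∀ S : RankOne lam, f (aOp (RankOne lam) S) = aOp (F.SubQuot G) (f S) := by
    intro S
    have h1 : aOp (F.SubQuot G) (q ⟨x, hx⟩) =
        (PowerSeries.C lam * PowerSeries.X : ℂ⟦X⟧) • q ⟨x, hx⟩ := by
      have := (hq (aOp G.toSubmodule ⟨x, hx⟩ -
        (PowerSeries.C lam * PowerSeries.X : ℂ⟦X⟧) • (⟨x, hx⟩ : G.toSubmodule))).2 hax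
      rw [map_sub, map_smul, sub_eq_zero] at this
      exact this
    have h2 : ∀ S : ℂ⟦X⟧, aOp (F.SubQuot G) (S • q ⟨x, hx⟩) = rankOneA lam S • q ⟨x, hx⟩ := by
      intro S
      rw [aOp_smul, h1, smul_smul, ← add_smul, rankOneA_apply, mul_comm S, add_comm]
    exact (h2 S).symm
  let g : RankOne lam ≃ₗ[ℂ⟦X⟧] F.SubQuot G := LinearEquiv.ofBijective f ⟨hinj, hsurj⟩
  refine ⟨g.symm, fun z => ?_⟩
  obtain ⟨S, rfl⟩ := g.surjective z
  rw [g.symm_apply_apply, g.symm_apply_eq]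
  exact (hcomm S).symm

variable {E' : Type v} [AddCommGroup E'] [Module ℂ⟦X⟧ E'] [ABStructure E']

theorem ABSubmodule.subQuot_abIso (f : E ≃ₗ[ℂ⟦X⟧] E') (hf : ∀ x, f (aOp E x) = aOp E' (f x))
    {F G : ABSubmodule E} {F' G' : ABSubmodule E'}
    (hF : F'.toSubmodule = F.toSubmodule.map (f : E →ₗ[ℂ⟦X⟧] E'))
    (hG : G'.toSubmodule = G.toSubmodule.map (f : E →ₗ[ℂ⟦X⟧] E')) :
    ABIso (F.SubQuot G) (F'.SubQuot G') := by
  let g : G.toSubmodule ≃ₗ[ℂ⟦X⟧] G'.toSubmodule := f.ofSubmodules _ _ hG.symm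
  have hg : ∀ x : G.toSubmodule, ((g x : G'.toSubmodule) : E') = f x := fun _ => rfl
  have hmap : (F.within G).toSubmodule.map (g : G.toSubmodule →ₗ[ℂ⟦X⟧] G'.toSubmodule) =
      (F'.within G').toSubmodule := by
    ext y
    obtain ⟨x, rfl⟩ := g.surjective y
    constructor
    · rintro ⟨z, hz, hzx⟩
      change ((g x : G'.toSubmodule) : E') ∈ F'.toSubmodule
      rw [hF, ← hzx]
      exact ⟨z, hz, rfl⟩
    · intro hx
      replace hx : ((g x : G'.toSubmodule) : E') ∈ F'.toSubmodule := hx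
      rw [hF, hg] at hx
      obtain ⟨z, hz, hzx⟩ := hx
      rw [f.injective hzx] at hz
      exact ⟨x, hz, rfl⟩
  refine ⟨Submodule.Quotient.equiv _ _ g hmap, fun z => ?_⟩
  obtain ⟨x, rfl⟩ := Submodule.Quotient.mk_surjective _ z
  exact congrArg (Submodule.Quotient.mk (p := (F'.within G').toSubmodule))
    (Subtype.ext (hf x) : g (aOp G.toSubmodule x) = aOp G'.toSubmodule (g x))

theorem IsTriangular.map (f : E ≃ₗ[ℂ⟦X⟧] E') (hf : ∀ x, f (aOp E x) = aOp E' (f x)) {n : ℕ}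
    {e : ℕ → E} {lam : ℕ → ℂ} (h : IsTriangular n e lam) :
    IsTriangular n (fun i => f (e i)) lam := by
  have hmem : ∀ (j : ℕ) (x : E), f x ∈ flagSpan (fun i => f (e i)) j ↔ x ∈ flagSpan e j := by
    intro j x
    rw [← map_flagSpan, Submodule.mem_map_equiv, f.symm_apply_apply]
  refine ⟨fun j hj => ?_, fun j hj S hS => ?_⟩
  · rw [aSub_apply, ← hf, ← map_smul, ← map_sub, hmem]
    exact h.op j hj
  · rw [← map_smul, hmem] at hS
    exact h.indep j hj S hS

end Quotients

/-! ### Jordan–Hölder sequences -/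

section JordanHolder

variable {E : Type u} [AddCommGroup E] [Module ℂ⟦X⟧ E] [ABStructure E] {k : ℕ}

/-- The numbers `λ_j`, as a sequence of complex numbers indexed by `ℕ`. -/
noncomputable def extendLam (lam : Fin k → ℚ) (j : ℕ) : ℂ :=
  if h : j < k then ((lam ⟨j, h⟩ : ℚ) : ℂ) else 0

theorem extendLam_apply (lam : Fin k → ℚ) (j : Fin k) : extendLam lam j = ((lam j : ℚ) : ℂ) := by
  rw [extendLam, dif_pos j.2]

theorem IsPrincipalJH.exists_triangular {ord : LinearOrder (AddCircle (1 : ℚ))}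
    {F : Fin (k + 1) → ABSubmodule E} {lam : Fin k → ℚ} (h : IsPrincipalJH ord F lam) :
    ∃ e : ℕ → E, IsTriangular k e (extendLam lam) ∧ flagSpan e k = ⊤ ∧
      ∀ j : Fin (k + 1), (F j).toSubmodule = flagSpan e j := by
  choose x hx hax hind hgen using fun j : Fin k => ABSubmodule.exists_generator (h.iso j)
  let e : ℕ → E := fun j => if hj : j < k then x ⟨j, hj⟩ else 0
  have he : ∀ j : Fin k, e j = x j := fun j => by simp [e]
  have hflag : ∀ (j : ℕ) (hj : j < k + 1), (F ⟨j, hj⟩).toSubmodule = flagSpan e j := by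
    intro j
    induction j with
    | zero => intro hj; rw [flagSpan_zero]; exact h.jh.zero
    | succ j ih =>
      intro hj
      have hj' : j < k := by omega
      have ih : (F (Fin.castSucc ⟨j, hj'⟩)).toSubmodule = flagSpan e j := ih (by omega)
      have hej := he ⟨j, hj'⟩
      have hle : flagSpan e j ≤ (F (Fin.succ ⟨j, hj'⟩)).toSubmodule := ih ▸ h.jh.le ⟨j, hj'⟩
      refine le_antisymm (fun y hy => ?_) (fun y hy => ?_)
      · obtain ⟨S, hS⟩ := hgen ⟨j, hj'⟩ y hy
        rw [ih, ← hej] at hS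
        exact mem_flagSpan_succ.2 ⟨S, _, hS, by abel⟩
      · obtain ⟨S, w, hw, rfl⟩ := mem_flagSpan_succ.1 hy
        refine add_mem (Submodule.smul_mem _ _ ?_) (hle hw)
        have := hx ⟨j, hj'⟩
        rwa [← hej] at this
  refine ⟨e, ⟨fun j hj => ?_, fun j hj => ?_⟩, ?_, fun j => hflag j j.2⟩
  · have h1 := hax ⟨j, hj⟩
    rw [← he, ← extendLam_apply] at h1
    exact hflag j (by omega) ▸ h1
  · have h1 := hind ⟨j, hj⟩
    rw [← he] at h1
    exact hflag j (by omega) ▸ h1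
  · rw [← hflag k (by omega)]; exact h.jh.last

/-- The steps of the flag of a triangular basis are normal. -/
theorem IsTriangular.mem_of_X_smul_mem {e : ℕ → E} {lam : ℕ → ℂ} (h : IsTriangular k e lam)
    (htop : flagSpan e k = ⊤) {j : ℕ} {x : E}
    (hx : (PowerSeries.X : ℂ⟦X⟧) • x ∈ flagSpan e j) : x ∈ flagSpan e j := by
  obtain ⟨T, rfl⟩ := exists_sum_of_mem_flagSpan (htop ▸ Submodule.mem_top : x ∈ flagSpan e k)
  simp only [Finset.smul_sum, smul_smul] at hx
  have h1 := sum_smul_mem_flagSpan h.indep _ hx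
  refine sum_mem fun i hi => ?_
  rcases lt_or_ge i j with hij | hij
  · exact Submodule.smul_mem _ _ (mem_flagSpan e hij)
  · rw [(mul_eq_zero.1 (h1 i hij (Finset.mem_range.1 hi))).resolve_left PowerSeries.X_ne_zero,
      zero_smul]
    exact zero_mem _

/-- The flag of a triangular basis is a Jordan–Hölder sequence. -/
theorem IsTriangular.isPrincipalJH {ord : LinearOrder (AddCircle (1 : ℚ))} {e : ℕ → E}
    {lam : Fin k → ℚ} (h : IsTriangular k e (extendLam lam)) (htop : flagSpan e k = ⊤)
    (hincr : ∀ i j : Fin k, i ≤ j →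
      ratLE ord (lam i + ((i : ℕ) + 1 : ℚ)) (lam j + ((j : ℕ) + 1 : ℚ))) :
    IsPrincipalJH ord (fun j : Fin (k + 1) => h.flag (Nat.lt_succ_iff.1 j.2)) lam := by
  have hiso : ∀ j : Fin k, ABIso ((h.flag (Nat.lt_succ_iff.1 j.castSucc.2)).SubQuot
      (h.flag (Nat.lt_succ_iff.1 j.succ.2))) (RankOne (lam j : ℂ)) := by
    intro j
    refine ABSubmodule.abIso_of_generator (x := e j) (mem_flagSpan e (by simp)) ?_
      (h.indep j j.2) fun y hy => ?_
    · rw [← extendLam_apply]; exact h.op j j.2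
    · obtain ⟨S, w, hw, rfl⟩ := mem_flagSpan_succ.1 hy
      exact ⟨S, by rw [add_sub_cancel_left]; exact hw⟩
  refine ⟨⟨flagSpan_zero e, htop, fun j => flagSpan_mono e (by simp), fun j => ?_, fun j => ?_⟩,
    hiso, hincr⟩
  · refine le_antisymm ?_ ?_
    · rintro _ ⟨hx, y, -, rfl⟩
      exact ⟨y, h.mem_of_X_smul_mem htop hx, rfl⟩
    · rintro _ ⟨y, hy, rfl⟩
      exact ⟨Submodule.smul_mem _ _ hy, y, trivial, rfl⟩
  · obtain ⟨f, -⟩ := hiso j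
    rw [f.finrank_eq]
    exact Module.finrank_self ℂ⟦X⟧

theorem IsPrincipalJH.bernsteinPoly_eq {ord : LinearOrder (AddCircle (1 : ℚ))}
    (hE : IsFresco E) {F : Fin (k + 1) → ABSubmodule E} {lam : Fin k → ℚ}
    (h : IsPrincipalJH ord F lam) :
    bernsteinPoly E = ∏ j : Fin k, (Polynomial.X +
      Polynomial.C (((lam j + ((j : ℕ) + 1 : ℚ) - (k : ℚ) : ℚ)) : ℂ)) := by
  obtain ⟨e, ht, htop, -⟩ := h.exists_triangular
  rw [hE.bernsteinPoly_eq ht htop]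
  refine Finset.prod_congr rfl fun j _ => ?_
  rw [extendLam_apply]
  push_cast
  rfl

theorem IsPrincipalJH.pos {ord : LinearOrder (AddCircle (1 : ℚ))}
    (hE : IsFresco E) {F : Fin (k + 1) → ABSubmodule E} {lam : Fin k → ℚ}
    (h : IsPrincipalJH ord F lam) (j : Fin k) : 0 < lam j := by
  obtain ⟨e, ht, htop, -⟩ := h.exists_triangular
  obtain ⟨q, hq, hlam⟩ := hE.exists_rat ht htop j
  rw [extendLam_apply] at hlam
  have h1 : lam j + ((j : ℕ) + 1) - k = q := by exact_mod_cast hlam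
  have h2 : ((j : ℕ) + 1 : ℚ) ≤ k := by exact_mod_cast j.2
  linarith

theorem IsPrincipalJH.incr_sub {ord : LinearOrder (AddCircle (1 : ℚ))}
    {F : Fin (k + 1) → ABSubmodule E} {lam : Fin k → ℚ} (h : IsPrincipalJH ord F lam)
    (i j : Fin k) (hij : i ≤ j) :
    ratLE ord (lam i + ((i : ℕ) + 1 : ℚ) - (k : ℚ)) (lam j + ((j : ℕ) + 1 : ℚ) - (k : ℚ)) :=
  ratLE_sub_natCast ord k (h.incr i j hij)

/-- The principal Jordan–Hölder sequence of a fresco is unique, as well as its numbers `λ_j`. -/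
theorem IsPrincipalJH.unique {ord : LinearOrder (AddCircle (1 : ℚ))} (hE : IsFresco E)
    {F G : Fin (k + 1) → ABSubmodule E} {lam mu : Fin k → ℚ}
    (hF : IsPrincipalJH ord F lam) (hG : IsPrincipalJH ord G mu) : lam = mu ∧ F = G := by
  have hlam : lam = mu := by
    have h1 := eq_of_prod_eq_of_ratLE ord hF.incr_sub hG.incr_sub
      ((hF.bernsteinPoly_eq hE).symm.trans (hG.bernsteinPoly_eq hE))
    funext j
    have := congrFun h1 j
    simpa using this
  subst hlam
  refine ⟨rfl, funext fun j => ABSubmodule.ext ?_⟩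
  obtain ⟨e, ht, htop, he⟩ := hF.exists_triangular
  obtain ⟨g, ht', htop', hg⟩ := hG.exists_triangular
  obtain ⟨e', U, hc, he'⟩ := hE.exists_chain ht htop
  obtain ⟨g', U', hc', hg'⟩ := hE.exists_chain ht' htop'
  have hj : (j : ℕ) ≤ k := Nat.lt_succ_iff.1 j.2
  refine congrArg (fun N : Submodule ℂ⟦X⟧ E => (N : Set E)) ?_
  rw [he, hg, ← he' j hj, ← hg' j hj]
  refine hc.flagSpan_eq ((he' k le_rfl).trans htop) hc' ((hg' k le_rfl).trans htop') ?_ hj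
  intro i m him hm N hN
  have h1 := extendLam_apply lam ⟨i, him.trans hm⟩
  have h2 := extendLam_apply lam ⟨m, hm⟩
  simp only at h1 h2
  rw [h1, h2] at hN
  have hN' : lam ⟨i, him.trans hm⟩ = lam ⟨m, hm⟩ + N := by exact_mod_cast hN
  -- `λ_i + i` and `λ_m + m` have the same class modulo `ℤ`, so they are ordered in the usual way.
  have h3 := hF.incr ⟨i, him.trans hm⟩ ⟨m, hm⟩ him.le
  have hclass : ∀ (l : ℚ) (p : ℕ), ((l + ((p : ℚ) + 1) : ℚ) : AddCircle (1 : ℚ)) = l := fun l p =>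
    coe_eq_coe_of_add_natCast (n := p + 1) (by push_cast; ring)
  have h4 := le_of_ratLE ord h3 (by
    rw [hclass, hclass]; exact coe_eq_coe_of_add_natCast hN')
  simp only [hN'] at h4
  have h5 : ((N + i : ℕ) : ℚ) ≤ m := by push_cast; linarith
  exact_mod_cast h5

end JordanHolder

/-! ### The principal Jordan–Hölder sequence of a fresco -/

theorem theorem1p2p8
    -- a total order on `ℚ / ℤ`
    (ord : LinearOrder (AddCircle (1 : ℚ)))
    -- a fresco `E` of rank `k`
    {E : Type u} [AddCommGroup E] [Module ℂ⟦X⟧ E] [ABStructure E] (hE : IsFresco E)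
    (k : ℕ) (hk : Module.finrank ℂ⟦X⟧ E = k) :
    -- existence and uniqueness of the principal Jordan–Hölder sequence
    (∃! F : Fin (k + 1) → ABSubmodule E, ∃ lam : Fin k → ℚ, IsPrincipalJH ord F lam) ∧
    ∀ (F : Fin (k + 1) → ABSubmodule E) (lam : Fin k → ℚ), IsPrincipalJH ord F lam →
      -- the fundamental invariants are positive
      (∀ j, 0 < lam j) ∧
      -- the opposites of the roots of the Bernstein polynomial, with multiplicities, are the
      -- numbers `λ_j + j - k`, and these appear in increasing order
      bernsteinPoly E = ∏ j : Fin k, (Polynomial.X +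
        Polynomial.C (((lam j + ((j : ℕ) + 1 : ℚ) - (k : ℚ) : ℚ)) : ℂ)) ∧
      (∀ i j : Fin k, i ≤ j →
        ratLE ord (lam i + ((i : ℕ) + 1 : ℚ) - (k : ℚ)) (lam j + ((j : ℕ) + 1 : ℚ) - (k : ℚ))) ∧
      -- invariance under isomorphisms
      ∀ (E' : Type v) [AddCommGroup E'] [Module ℂ⟦X⟧ E'] [ABStructure E'], ABIso E E' →
        ∀ (F' : Fin (k + 1) → ABSubmodule E') (lam' : Fin k → ℚ), IsPrincipalJH ord F' lam' →
          lam' = lam ∧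
          ∀ i j : Fin (k + 1), i ≤ j →
            ABIso ((F i).SubQuot (F j)) ((F' i).SubQuot (F' j)) := by
  refine ⟨?_, fun F lam hF => ⟨hF.pos hE, hF.bernsteinPoly_eq hE, hF.incr_sub, ?_⟩⟩
  · obtain ⟨e, nu, mu, ht, htop, hnu, hsort⟩ := hE.exists_sorted_triangular ord hk
    let lam : Fin k → ℚ := fun j => mu j - ((j : ℕ) + 1)
    have ht' : IsTriangular k e (extendLam lam) := by
      refine ⟨fun j hj => ?_, ht.indep⟩
      have h1 := ht.op j hj
      rw [hnu ⟨j, hj⟩] at h1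
      rw [extendLam, dif_pos hj]
      exact h1
    refine ⟨_, ⟨lam, ht'.isPrincipalJH htop fun i j hij => ?_⟩, ?_⟩
    · simpa [lam] using hsort i j hij
    · rintro G ⟨nu', hG⟩
      exact (hG.unique hE (ht'.isPrincipalJH htop fun i j hij => by
        simpa [lam] using hsort i j hij)).2
  · rintro E' _ _ _ ⟨f, hf⟩ F' lam' hF'
    obtain ⟨g, hg, hgtop, hgF⟩ := hF'.exists_triangular
    have hf' : ∀ x, f.symm (aOp E' x) = aOp E (f.symm x) := fun x => by
      rw [f.symm_apply_eq, hf, f.apply_symm_apply]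
    have ht := hg.map f.symm hf'
    have htop : flagSpan (fun i => f.symm (g i)) k = ⊤ := by
      rw [← map_flagSpan f.symm, hgtop, Submodule.map_top,
        LinearMap.range_eq_top]
      exact f.symm.surjective
    obtain ⟨hlam, hFF⟩ := (ht.isPrincipalJH htop hF'.incr).unique hE hF
    refine ⟨hlam, fun i j _ => ?_⟩
    have hmap : ∀ i, (F' i).toSubmodule = (F i).toSubmodule.map (f : E →ₗ[ℂ⟦X⟧] E') := by
      intro i
      rw [← hFF, hgF]
      change _ = (flagSpan (fun i => f.symm (g i)) i).map (f : E →ₗ[ℂ⟦X⟧] E')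
      rw [map_flagSpan]
      congr 1
      funext i
      simp
    exact ABSubmodule.subQuot_abIso f hf (hmap i) (hmap j)
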